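/- Let $G_{SM} = U(1)\times SU(2)\times SU(3)$ and let $$\phi\colon G_{SM}\to SU(5),\qquad \phi(\alpha,g,h)=\begin{pmatrix}\alpha^{3}g&0\\0&\alpha^{-2}h\end{pmatrix},$$ where $SU(5)$ acts on $\mathbb C^5=\mathbb C^2\oplus\mathbb C^3$. Its kernel is $\mathbb Z_6=\{(\alpha,\alpha^{-3},\alpha^{2}) : \alpha^6=1\}$. Regard $\mathbb R^4,\mathbb R^6,\mathbb R^{10}=\mathbb R^4\oplus\mathbb R^6$ as the real inner product spaces underlying $\mathbb C^2,\mathbb C^3,\mathbb C^5=\mathbb C^2\oplus\mathbb C^3$. Let $\eta\colon \mathrm{Spin}(4)\times \mathrm{Spin}(6)\to \mathrm{Spin}(10)$ be the homomorphism lifting the block diagonal inclusion $SO(4)\times SO(6)\to SO(10)$ (multiplication in the Clifford algebra); its kernel is $\mathbb Z_2=\{(1,1),(-1,-1)\}$. Let $\psi\colon SU(5)\to \mathrm{Spin}(10)$ be the unique homomorphism lifting the inclusion $SU(5)\to SO(10)$ along the double cover $\mathrm{Spin}(10)\to SO(10)$. Let $\theta\colon G_{SM}\to \mathrm{Spin}(4)\times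 \mathrm{Spin}(6)$ be the composite of $$G_{SM}\to SU(2)\times SU(2)\times SU(4),\quad (\alpha,g,h)\mapsto\left(g,\ \begin{pmatrix}\alpha^3&0\\0&\alpha^{-3}\end{pmatrix},\ \begin{pmatrix}\alpha h&0\\0&\alpha^{-3}\end{pmatrix}\right)$$ with the isomorphism $SU(2)\times SU(2)\times SU(4)\cong \mathrm{Spin}(4)\times \mathrm{Spin}(6)$ under which the Dirac spinor representations $\Lambda\mathbb C^2$ of $\mathrm{Spin}(4)$ and $\Lambda\mathbb C^3$ of $\mathrm{Spin}(6)$ become $(\mathbb C^2\otimes\mathbb C)\oplus(\mathbb C\otimes\mathbb C^2)$ and $\mathbb C^4\oplus\mathbb C^{4*}$, by the identifications $u_L\mapsto u$, $d_L\mapsto d$, $u_R\mapsto u\wedge d$, $d_R\mapsto 1$, and $r,g,b,w\mapsto r,g,b,r\wedge g\wedge b$, $\bar r,\bar g,\bar b,\bar w\mapsto g\wedge b,b\wedge r,r\wedge g,1$ of standard bases. Then $\psi$ is injective, and $\phi,\theta,\eta$ induce injective homomorphisms $\tilde\phi\colon G_{SM}/\mathbb Z_6\to SU(5)$, $\tilde\theta\colon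 G_{SM}/\mathbb Z_6\to(\mathrm{Spin}(4)\times \mathrm{Spin}(6))/\mathbb Z_2$ and $\tilde\eta\colon(\mathrm{Spin}(4)\times \mathrm{Spin}(6))/\mathbb Z_2\to \mathrm{Spin}(10)$. Inside $\mathrm{Spin}(10)$, $$G_{SM}/\mathbb Z_6 \;=\; SU(5)\,\cap\,(\mathrm{Spin}(4)\times \mathrm{Spin}(6))/\mathbb Z_2,$$ that is, $\operatorname{im}(\psi\tilde\phi)=\operatorname{im}\psi\cap\operatorname{im}\tilde\eta$; moreover the square $\psi\tilde\phi=\tilde\eta\tilde\theta$ commutes and is a pullback square of groups. -/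

import Mathlib

open scoped Matrix

namespace GUT

noncomputable section

/-! ### The complex space `ℂ^ι` and its underlying real quadratic space -/

/-- `ℂ^ι` with its standard Hermitian inner product; it is also the real inner product space
`ℝ^(2|ι|)` once the complex structure is forgotten. -/
abbrev CSpace (ι : Type) [Fintype ι] : Type := EuclideanSpace ℂ ι

/-- The quadratic form `v ↦ -‖v‖²` on the real vector space underlying `ℂ^ι`. With this form the
Clifford relations read `v w + w v = -2 ⟨v, w⟩`. -/
def cliffForm (ι : Type) [Fintype ι] : QuadraticForm ℝ (CSpace ι) :=
  -LinearMap.BilinMap.toQuadraticMap (innerₗ (CSpace ι))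

theorem cliffForm_apply {ι : Type} [Fintype ι] (v : CSpace ι) :
    cliffForm ι v = -(‖v‖ ^ 2) := by
  simp [cliffForm, LinearMap.BilinMap.toQuadraticMap_apply]

/-- The Clifford algebra `Cliff_{2n}` of the real inner product space underlying `ℂ^ι`, `n = |ι|`. -/
abbrev Cliff (ι : Type) [Fintype ι] : Type := CliffordAlgebra (cliffForm ι)

/-- `Spin(2n)`, `n = |ι|`, realised inside the Clifford algebra. -/
abbrev Spin (ι : Type) [Fintype ι] : Type := spinGroup (cliffForm ι)

/-- `SU(n)`, `n = |ι|`. -/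
abbrev SU (ι : Type) [Fintype ι] [DecidableEq ι] : Type := Matrix.specialUnitaryGroup ι ℂ

/-- The linear action of a matrix on `ℂ^ι`. -/
abbrev act {ι : Type} [Fintype ι] [DecidableEq ι] (A : Matrix ι ι ℂ) :
    CSpace ι →ₗ[ℂ] CSpace ι := Matrix.toEuclideanLin A

/-- `CoversRotation x A` says that the covering map `p : Spin(2n) → SO(2n)`, which sends `x` to
the rotation `v ↦ x v x⁻¹` of the real vector space underlying `ℂ^ι`, takes `x` to the rotation
given by the matrix `A`. -/
def CoversRotation {ι : Type} [Fintype ι] [DecidableEq ι] (x : Spin ι) (A : Matrix ι ι ℂ) : Prop :=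
  ∀ v : CSpace ι,
    (x : Cliff ι) * CliffordAlgebra.ι (cliffForm ι) v * ((x⁻¹ : Spin ι) : Cliff ι) =
      CliffordAlgebra.ι (cliffForm ι) (act A v)

/-! ### The Dirac spinor representation -/

/-- The exterior algebra `Λ ℂ^ι`. -/
abbrev Ext (ι : Type) [Fintype ι] : Type := ExteriorAlgebra ℂ (CSpace ι)

/-- The creation operator `ψ ↦ v ∧ ψ`. -/
def creation {ι : Type} [Fintype ι] (v : CSpace ι) : Module.End ℂ (Ext ι) :=
  LinearMap.mulLeft ℂ (ExteriorAlgebra.ι ℂ v)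

/-- The annihilation operator: the antiderivation of the exterior algebra that sends
`w ∈ ℂ^ι` to `⟨v, w⟩`. -/
def annihilation {ι : Type} [Fintype ι] (v : CSpace ι) : Module.End ℂ (Ext ι) :=
  CliffordAlgebra.contractLeft (Q := (0 : QuadraticForm ℂ (CSpace ι))) (innerₛₗ ℂ v)

/-- The operator of Clifford multiplication by `v` on the exterior algebra. On the standard real
basis `e_j, i e_j` its values are `i (a_j + a_j*)` and `a_j - a_j*`. -/
def gammaOp (ι : Type) [Fintype ι] : CSpace ι →ₗ[ℝ] Module.End ℂ (Ext ι) where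
  toFun v := Complex.I • (annihilation v + creation v)
  map_add' v w := by
    refine LinearMap.ext fun x => ?_
    simp only [annihilation, creation, LinearMap.smul_apply, LinearMap.add_apply, map_add,
      LinearMap.mulLeft_apply, add_mul, smul_add]
    abel
  map_smul' r v := by
    have h : r • v = (r : ℂ) • v := by
      ext i
      simp
    have h1 : annihilation (r • v) = (r : ℂ) • annihilation v := by
      refine LinearMap.ext fun x => ?_
      have h6 : innerₛₗ ℂ ((r : ℂ) • v) = (r : ℂ) • innerₛₗ ℂ v := by
        rw [LinearMap.map_smulₛₗ]
        simp
      rw [h, annihilation, h6, map_smul]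
      rfl
    have h2 : creation (r • v) = (r : ℂ) • creation v := by
      rw [h]
      refine LinearMap.ext fun x => ?_
      rw [creation, map_smul, LinearMap.mulLeft_apply, smul_mul_assoc]
      rfl
    rw [h1, h2, ← smul_add, smul_comm, Complex.coe_smul]
    rfl

theorem gammaOp_sq {ι : Type} [Fintype ι] (v : CSpace ι) :
    gammaOp ι v * gammaOp ι v = algebraMap ℝ (Module.End ℂ (Ext ι)) (cliffForm ι v) := by
  refine LinearMap.ext fun x => ?_
  have h0 : ExteriorAlgebra.ι ℂ v * ExteriorAlgebra.ι ℂ v = 0 := ExteriorAlgebra.ι_sq_zero v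
  have h1 : annihilation v (annihilation v x) = 0 := CliffordAlgebra.contractLeft_contractLeft _ _
  have h2 : creation v (creation v x) = 0 := by
    simp [creation, ← mul_assoc, h0]
  have h3 : annihilation v (creation v x) =
      (innerₛₗ ℂ v v) • x - creation v (annihilation v x) :=
    CliffordAlgebra.contractLeft_ι_mul _ _ _
  have h4 : algebraMap ℝ (Module.End ℂ (Ext ι)) (cliffForm ι v) x =
      ((cliffForm ι v : ℝ) : ℂ) • x := by
    rw [Module.algebraMap_end_apply, Complex.coe_smul]
  rw [h4]
  have h5 : (innerₛₗ ℂ v) v = ((‖v‖ ^ 2 : ℝ) : ℂ) := by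
    simp
  simp only [gammaOp, LinearMap.coe_mk, AddHom.coe_mk, Module.End.mul_apply, LinearMap.smul_apply,
    LinearMap.add_apply, map_smul, map_add, smul_add, smul_smul, h1, h2, h3, h5,
    Complex.I_mul_I, cliffForm_apply]
  simp only [smul_zero, zero_add, add_zero, smul_sub, Complex.ofReal_neg, neg_smul, one_smul]
  abel

/-- The action of the Clifford algebra on the exterior algebra. -/
def cliffAct (ι : Type) [Fintype ι] : Cliff ι →ₐ[ℝ] Module.End ℂ (Ext ι) :=
  CliffordAlgebra.lift (cliffForm ι) ⟨gammaOp ι, gammaOp_sq⟩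

/-- The Dirac spinor representation of `Spin(2n)` on `Λ ℂ^n`. -/
def dirac (ι : Type) [Fintype ι] : Spin ι →* Module.End ℂ (Ext ι) :=
  ((cliffAct ι : Cliff ι →* Module.End ℂ (Ext ι))).comp (spinGroup (cliffForm ι)).subtype

/-! ### The groups and `φ : G_SM → SU(5)` -/

/-- `SU(5)`, acting on `ℂ⁵ = ℂ² ⊕ ℂ³`. -/
abbrev SU5 : Type := SU (Fin 2 ⊕ Fin 3)

/-- `Spin(10)`, for `ℝ¹⁰` the real vector space underlying `ℂ⁵ = ℂ² ⊕ ℂ³`. -/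
abbrev Spin10 : Type := Spin (Fin 2 ⊕ Fin 3)

/-- `Spin(4)`, for `ℝ⁴` the real vector space underlying `ℂ²`. -/
abbrev Spin4 : Type := Spin (Fin 2)

/-- `Spin(6)`, for `ℝ⁶` the real vector space underlying `ℂ³`. -/
abbrev Spin6 : Type := Spin (Fin 3)

/-- The gauge group of the Standard Model, `U(1) × SU(2) × SU(3)`. -/
abbrev GSM : Type := Circle × SU (Fin 2) × SU (Fin 3)


theorem SU.isUnitary {ι : Type} [Fintype ι] [DecidableEq ι] (A : SU ι) :
    (A : Matrix ι ι ℂ) * (A : Matrix ι ι ℂ)ᴴ = 1 :=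
  Matrix.mem_unitaryGroup_iff.1 A.2.1

theorem SU.det_eq {ι : Type} [Fintype ι] [DecidableEq ι] (A : SU ι) :
    (A : Matrix ι ι ℂ).det = 1 := A.2.2

theorem circle_mul_star (z : Circle) : (z : ℂ) * star (z : ℂ) = 1 := by
  simp [Complex.mul_conj, Complex.normSq_eq_norm_sq, Circle.norm_coe]

theorem blocks_mem {m n : Type} [Fintype m] [DecidableEq m] [Fintype n] [DecidableEq n]
    (z w : Circle) (A : SU m) (B : SU n)
    (h : (z : ℂ) ^ Fintype.card m * (w : ℂ) ^ Fintype.card n = 1) :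
    Matrix.fromBlocks ((z : ℂ) • (A : Matrix m m ℂ)) 0 0 ((w : ℂ) • (B : Matrix n n ℂ)) ∈
      Matrix.specialUnitaryGroup (m ⊕ n) ℂ := by
  rw [Matrix.mem_specialUnitaryGroup_iff, Matrix.mem_unitaryGroup_iff]
  constructor
  · rw [Matrix.star_eq_conjTranspose, Matrix.fromBlocks_conjTranspose, Matrix.fromBlocks_multiply]
    have hz := circle_mul_star z
    have hw := circle_mul_star w
    rw [mul_comm] at hz hw
    simp only [Matrix.conjTranspose_smul, Matrix.conjTranspose_zero, Matrix.mul_zero,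
      Matrix.zero_mul, add_zero, zero_add, Matrix.smul_mul, Matrix.mul_smul, smul_smul,
      SU.isUnitary, hz, hw, one_smul, smul_zero, Matrix.fromBlocks_one]
  · rw [Matrix.det_fromBlocks_zero₂₁, Matrix.det_smul, Matrix.det_smul, SU.det_eq, SU.det_eq,
      mul_one, mul_one, h]

/-- The block diagonal matrix with blocks `z A` and `w B`, as an element of a special unitary
group. -/
def blocks {m n : Type} [Fintype m] [DecidableEq m] [Fintype n] [DecidableEq n]
    (z w : Circle) (A : SU m) (B : SU n)
    (h : (z : ℂ) ^ Fintype.card m * (w : ℂ) ^ Fintype.card n = 1) : SU (m ⊕ n) :=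
  ⟨_, blocks_mem z w A B h⟩

/-- The homomorphism `φ : (α, g, h) ↦ diag (α³ g, α⁻² h)`. -/
def phi : GSM →* SU5 where
  toFun s := blocks (s.1 ^ 3) (s.1 ^ (-2 : ℤ)) s.2.1 s.2.2 (by
    have := s.1.coe_ne_zero
    simp
    field_simp)
  map_one' := by
    apply Subtype.ext
    simp [blocks]
  map_mul' s t := by
    apply Subtype.ext
    simp only [blocks, Submonoid.coe_mul, Matrix.fromBlocks_multiply, Prod.fst_mul, Prod.snd_mul,
      mul_pow, mul_zpow, Circle.coe_mul, Matrix.smul_mul, Matrix.mul_smul, smul_smul,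
      Matrix.mul_zero, Matrix.zero_mul, add_zero, zero_add]
    simp [mul_comm]

/-- The subgroup `ℤ₆ = {(α, α⁻³, α²) : α⁶ = 1}` of `G_SM`. -/
def Z6 : Subgroup GSM where
  carrier := {s | s.1 ^ 6 = 1 ∧
    (s.2.1 : Matrix (Fin 2) (Fin 2) ℂ) = ((s.1 : ℂ) ^ (-3 : ℤ)) • (1 : Matrix (Fin 2) (Fin 2) ℂ) ∧
    (s.2.2 : Matrix (Fin 3) (Fin 3) ℂ) = ((s.1 : ℂ) ^ 2) • (1 : Matrix (Fin 3) (Fin 3) ℂ)}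
  mul_mem' := by
    rintro s t ⟨h1, h2, h3⟩ ⟨k1, k2, k3⟩
    refine ⟨?_, ?_, ?_⟩
    · simp [mul_pow, h1, k1]
    · simp only [Prod.fst_mul, Prod.snd_mul, Submonoid.coe_mul, Circle.coe_mul, h2, k2, mul_zpow,
        Matrix.smul_mul, Matrix.mul_smul, one_mul, smul_smul]
      rw [mul_comm]
    · simp [h3, k3, mul_pow, smul_smul, mul_comm]
  one_mem' := by
    simp
  inv_mem' := by
    rintro s ⟨h1, h2, h3⟩
    refine ⟨?_, ?_, ?_⟩
    · simp [h1]
    · change star (s.2.1 : Matrix (Fin 2) (Fin 2) ℂ) = _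
      rw [h2, star_smul, star_one, Prod.fst_inv, Circle.coe_inv_eq_conj, star_zpow₀]
      rfl
    · change star (s.2.2 : Matrix (Fin 3) (Fin 3) ℂ) = _
      rw [h3, star_smul, star_one, Prod.fst_inv, Circle.coe_inv_eq_conj, star_pow]
      rfl

instance : Z6.Normal where
  conj_mem := by
    rintro s ⟨h1, h2, h3⟩ t
    have e : t * s * t⁻¹ = s := by
      rw [mul_inv_eq_iff_eq_mul]
      refine Prod.ext (mul_comm _ _) (Prod.ext (Subtype.ext ?_) (Subtype.ext ?_))
      · simp [h2]
      · simp [h3]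
    rw [e]
    exact ⟨h1, h2, h3⟩

theorem Z6_le_ker_phi : Z6 ≤ phi.ker := by
  rintro s ⟨h1, h2, h3⟩
  have hz := s.1.coe_ne_zero
  rw [MonoidHom.mem_ker]
  apply Subtype.ext
  simp only [phi, blocks, MonoidHom.coe_mk, OneHom.coe_mk, h2, h3, Submonoid.coe_one,
    ← Matrix.fromBlocks_one, smul_smul]
  congr 1
  · simp [hz]
  · simp [hz]

/-- The homomorphism `G_SM/ℤ₆ → SU(5)` induced by `φ`. -/
def phiBar : GSM ⧸ Z6 →* SU5 := QuotientGroup.lift Z6 phi Z6_le_ker_phi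

/-! ### `η : Spin(4) × Spin(6) → Spin(10)` -/

/-- The inclusion `ℂ² → ℂ² ⊕ ℂ³`, i.e. `ℝ⁴ → ℝ¹⁰`. -/
def embed4 : cliffForm (Fin 2) →qᵢ cliffForm (Fin 2 ⊕ Fin 3) where
  toFun v := WithLp.toLp 2 (Sum.elim v.ofLp 0)
  map_add' v w := by
    ext i
    cases i <;> simp
  map_smul' r v := by
    ext i
    cases i <;> simp
  map_app' v := by
    simp [cliffForm_apply, EuclideanSpace.norm_sq_eq]

/-- The inclusion `ℂ³ → ℂ² ⊕ ℂ³`, i.e. `ℝ⁶ → ℝ¹⁰`. -/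
def embed6 : cliffForm (Fin 3) →qᵢ cliffForm (Fin 2 ⊕ Fin 3) where
  toFun v := WithLp.toLp 2 (Sum.elim 0 v.ofLp)
  map_add' v w := by
    ext i
    cases i <;> simp
  map_smul' r v := by
    ext i
    cases i <;> simp
  map_app' v := by
    simp [cliffForm_apply, EuclideanSpace.norm_sq_eq]

theorem map_star_eq {m n : Type} [Fintype m] [Fintype n] (f : cliffForm m →qᵢ cliffForm n)
    (x : Cliff m) : CliffordAlgebra.map f (star x) = star (CliffordAlgebra.map f x) := by
  induction x using CliffordAlgebra.induction with
  | algebraMap r => simp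
  | ι v => simp
  | mul a b ha hb => simp [ha, hb]
  | add a b ha hb => simp [ha, hb]

theorem map_mem_spin {m n : Type} [Fintype m] [Fintype n] (f : cliffForm m →qᵢ cliffForm n)
    (x : Spin m) : CliffordAlgebra.map f (x : Cliff m) ∈ spinGroup (cliffForm n) := by
  refine ⟨⟨?_, ?_⟩, ?_⟩
  · obtain ⟨u, hu, hux⟩ := x.2.1.1
    refine ⟨Units.map (CliffordAlgebra.map f : Cliff m →* Cliff n) u, ?_, ?_⟩
    · have h : lipschitzGroup (cliffForm m) ≤ (lipschitzGroup (cliffForm n)).comap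
          (Units.map (CliffordAlgebra.map f : Cliff m →* Cliff n)) := by
        refine (Subgroup.closure_le _).2 ?_
        rintro a ⟨v, hv⟩
        refine Subgroup.subset_closure ⟨f v, ?_⟩
        rw [← CliffordAlgebra.map_apply_ι, hv]
        rfl
      exact h hu
    · rw [← hux]
      rfl
  · have h := x.2.1.2
    rw [SetLike.mem_coe, Unitary.mem_iff] at h ⊢
    rw [← map_star_eq, ← map_mul, ← map_mul, h.1, h.2, map_one]
    exact ⟨rfl, rfl⟩
  · have h : (x : Cliff m) ∈ CliffordAlgebra.evenOdd (cliffForm m) 0 := x.2.2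
    change _ ∈ CliffordAlgebra.evenOdd (cliffForm n) 0
    generalize (x : Cliff m) = y at h
    induction y, h using CliffordAlgebra.even_induction with
    | algebraMap r =>
      rw [AlgHom.commutes]
      exact SetLike.algebraMap_mem_graded (CliffordAlgebra.evenOdd (cliffForm n)) r
    | add a b _ _ ha hb =>
      rw [map_add]
      exact add_mem ha hb
    | ι_mul_ι_mul v w a _ ha =>
      rw [map_mul, map_mul, CliffordAlgebra.map_apply_ι, CliffordAlgebra.map_apply_ι]
      have := SetLike.mul_mem_graded (A := CliffordAlgebra.evenOdd (cliffForm n))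
        (CliffordAlgebra.ι_mul_ι_mem_evenOdd_zero (cliffForm n) (f v) (f w)) ha
      simpa using this

/-- The homomorphism of spin groups induced by an isometric embedding. -/
def spinMap {m n : Type} [Fintype m] [Fintype n] (f : cliffForm m →qᵢ cliffForm n) :
    Spin m →* Spin n where
  toFun x := ⟨CliffordAlgebra.map f (x : Cliff m), map_mem_spin f x⟩
  map_one' := by
    apply Subtype.ext
    simp
  map_mul' x y := by
    apply Subtype.ext
    simp

theorem embed_isOrtho (v : CSpace (Fin 2)) (w : CSpace (Fin 3)) :
    (cliffForm (Fin 2 ⊕ Fin 3)).IsOrtho (embed4 v) (embed6 w) := by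
  rw [QuadraticMap.isOrtho_def]
  have h4 : embed4 v = (WithLp.toLp 2 (Sum.elim v.ofLp 0) : CSpace (Fin 2 ⊕ Fin 3)) := rfl
  have h6 : embed6 w = (WithLp.toLp 2 (Sum.elim 0 w.ofLp) : CSpace (Fin 2 ⊕ Fin 3)) := rfl
  rw [h4, h6]
  simp only [cliffForm_apply, EuclideanSpace.norm_sq_eq, Fintype.sum_sum_type, PiLp.add_apply,
    Sum.elim_inl, Sum.elim_inr, Pi.zero_apply, add_zero, zero_add, norm_zero]
  simp
  ring

theorem spinMap_commute (x : Spin4) (y : Spin6) :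
    Commute (spinMap embed4 x) (spinMap embed6 y) := by
  apply Subtype.ext
  exact CliffordAlgebra.commute_map_mul_map_of_isOrtho_of_mem_evenOdd_zero_left embed4 embed6
    embed_isOrtho _ _ x.2.2 y.2.2

/-- The homomorphism `η : Spin(4) × Spin(6) → Spin(10)` lifting the block diagonal inclusion
`SO(4) × SO(6) → SO(10)`. -/
def eta : Spin4 × Spin6 →* Spin10 :=
  (spinMap embed4).noncommCoprod (spinMap embed6) spinMap_commute

theorem neg_one_mem_spin (n : Type) [Fintype n] [Nonempty n] :
    (-1 : Cliff n) ∈ spinGroup (cliffForm n) := by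
  classical
  have i : n := Classical.arbitrary n
  have hq : cliffForm n (EuclideanSpace.single i 1) = -1 := by
    simp [cliffForm_apply]
  have hs : CliffordAlgebra.ι (cliffForm n) (EuclideanSpace.single i 1) *
      CliffordAlgebra.ι (cliffForm n) (EuclideanSpace.single i 1) = -1 := by
    rw [CliffordAlgebra.ι_sq_scalar, hq, map_neg, map_one]
  refine ⟨⟨?_, ?_⟩, ?_⟩
  · let u : (Cliff n)ˣ := ⟨CliffordAlgebra.ι (cliffForm n) (EuclideanSpace.single i 1),
      -CliffordAlgebra.ι (cliffForm n) (EuclideanSpace.single i 1), by simp [hs], by simp [hs]⟩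
    have hu : u ∈ lipschitzGroup (cliffForm n) := Subgroup.subset_closure ⟨_, rfl⟩
    exact ⟨u * u, mul_mem hu hu, hs⟩
  · rw [SetLike.mem_coe, Unitary.mem_iff]
    simp
  · change _ ∈ CliffordAlgebra.evenOdd (cliffForm n) 0
    exact neg_mem (Submodule.one_le.1 (CliffordAlgebra.one_le_evenOdd_zero _))

/-- The element `-1` of the spin group. -/
def spinNegOne (n : Type) [Fintype n] [Nonempty n] : Spin n := ⟨-1, neg_one_mem_spin n⟩

theorem spinNegOne_comm {n : Type} [Fintype n] [Nonempty n] (x : Spin n) :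
    x * spinNegOne n = spinNegOne n * x := by
  apply Subtype.ext
  simp [spinNegOne]

theorem spinNegOne_sq {n : Type} [Fintype n] [Nonempty n] :
    spinNegOne n * spinNegOne n = 1 := by
  apply Subtype.ext
  simp [spinNegOne]

/-- The subgroup `ℤ₂ = {(1, 1), (-1, -1)}` of `Spin(4) × Spin(6)`. -/
def Z2 : Subgroup (Spin4 × Spin6) where
  carrier := {1, (spinNegOne (Fin 2), spinNegOne (Fin 3))}
  mul_mem' := by
    rintro a b (rfl | rfl) (rfl | rfl)
    · simp
    · simp
    · simp
    · left
      exact Prod.ext spinNegOne_sq spinNegOne_sq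
  one_mem' := Or.inl rfl
  inv_mem' := by
    rintro a (rfl | rfl)
    · simp
    · right
      rw [Set.mem_singleton_iff, inv_eq_iff_mul_eq_one]
      exact Prod.ext spinNegOne_sq spinNegOne_sq

instance : Z2.Normal where
  conj_mem := by
    rintro a (rfl | rfl) x
    · simp
    · have e : x * (spinNegOne (Fin 2), spinNegOne (Fin 3)) * x⁻¹ =
          (spinNegOne (Fin 2), spinNegOne (Fin 3)) := by
        rw [mul_inv_eq_iff_eq_mul]
        exact Prod.ext (spinNegOne_comm _) (spinNegOne_comm _)
      rw [e]
      exact Or.inr rfl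

theorem Z2_le_ker_eta : Z2 ≤ eta.ker := by
  rintro a (rfl | rfl)
  · exact eta.ker.one_mem
  · rw [MonoidHom.mem_ker]
    apply Subtype.ext
    simp [eta, spinMap, spinNegOne]

/-- The homomorphism `(Spin(4) × Spin(6))/ℤ₂ → Spin(10)` induced by `η`. -/
def etaBar : (Spin4 × Spin6) ⧸ Z2 →* Spin10 := QuotientGroup.lift Z2 eta Z2_le_ker_eta

/-! ### `ψ : SU(5) → Spin(10)` -/

/-- `ψ : SU(5) → Spin(10)` lifts the inclusion `SU(5) → SO(10)` along the covering map
`p : Spin(10) → SO(10)`. -/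
def IsSpinLift (ψ : SU5 →* Spin10) : Prop :=
  ∀ A : SU5, CoversRotation (ψ A) (A : Matrix (Fin 2 ⊕ Fin 3) (Fin 2 ⊕ Fin 3) ℂ)

/-! ### `θ : G_SM → Spin(4) × Spin(6)` -/

/-- `SU(4)`, acting on `ℂ⁴ = ℂ³ ⊕ ℂ` with basis `r, g, b, w`. -/
abbrev SU4 : Type := SU (Fin 3 ⊕ Fin 1)

/-- The matrix `diag (z, z⁻¹)` in `SU(2)`. -/
def diagSU2 (z : Circle) : SU (Fin 2) :=
  ⟨Matrix.diagonal ![(z : ℂ), ((z⁻¹ : Circle) : ℂ)], by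
    rw [Matrix.mem_specialUnitaryGroup_iff, Matrix.mem_unitaryGroup_iff]
    have hz := circle_mul_star z
    have hw := circle_mul_star z⁻¹
    constructor
    · rw [Matrix.star_eq_conjTranspose, Matrix.diagonal_conjTranspose, Matrix.diagonal_mul_diagonal,
        ← Matrix.diagonal_one]
      congr 1
      funext i
      fin_cases i
      · exact hz
      · exact hw
    · simp [Matrix.det_diagonal]⟩

/-- The homomorphism `β : G_SM → SU(2) × SU(2) × SU(4)`,
`(α, g, h) ↦ (g, diag (α³, α⁻³), diag (α h, α⁻³))`. -/
def beta : GSM →* SU (Fin 2) × SU (Fin 2) × SU4 where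
  toFun s := (s.2.1, diagSU2 (s.1 ^ 3), blocks s.1 (s.1 ^ (-3 : ℤ)) s.2.2 1 (by
    have := s.1.coe_ne_zero
    simp [this]))
  map_one' := by
    refine Prod.ext rfl (Prod.ext (Subtype.ext ?_) (Subtype.ext ?_))
    · ext i j
      fin_cases i <;> fin_cases j <;> simp [diagSU2]
    · simp [blocks]
  map_mul' s t := by
    refine Prod.ext rfl (Prod.ext (Subtype.ext ?_) (Subtype.ext ?_))
    · ext i j
      fin_cases i <;> fin_cases j <;> simp [diagSU2, mul_pow, mul_comm]
    · simp only [blocks, Submonoid.coe_mul, Matrix.fromBlocks_multiply, Prod.fst_mul,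
        Prod.snd_mul, mul_zpow, Circle.coe_mul, Matrix.smul_mul, Matrix.mul_smul, smul_smul,
        Matrix.mul_zero, Matrix.zero_mul, add_zero, zero_add, Submonoid.coe_one, mul_one]
      simp [mul_comm]

/-- A vector of `ℂⁿ`, placed in degree one of the exterior algebra. -/
def degOne {ι : Type} [Fintype ι] (p : ι → ℂ) : Ext ι := ExteriorAlgebra.ι ℂ (WithLp.toLp 2 p)

/-- A standard basis vector of `ℂⁿ`, placed in degree one of the exterior algebra. -/
def basisVec {ι : Type} [Fintype ι] [DecidableEq ι] (i : ι) : Ext ι := degOne (Pi.single i 1)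

/-- The identification `ℂ² ⊗ ℂ ⊕ ℂ ⊗ ℂ² ≅ Λ ℂ²`: `u_L ↦ u`, `d_L ↦ d`, `u_R ↦ u ∧ d`, `d_R ↦ 1`,
where `u, d` is the standard basis of `ℂ²`. -/
def isospinMap (p q : Fin 2 → ℂ) : Ext (Fin 2) :=
  degOne p + (q 0 • (basisVec 0 * basisVec 1) + q 1 • 1)

/-- The identification `ℂ⁴ ⊕ ℂ⁴* ≅ Λ ℂ³`: `r, g, b, w` go to `r, g, b, r ∧ g ∧ b`, and the dual
basis goes to `g ∧ b, b ∧ r, r ∧ g, 1`, where `r, g, b` is the standard basis of `ℂ³`. -/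
def colorMap (p q : Fin 3 ⊕ Fin 1 → ℂ) : Ext (Fin 3) :=
  (degOne (fun i => p (Sum.inl i)) + p (Sum.inr 0) • (basisVec 0 * basisVec 1 * basisVec 2)) +
    (q (Sum.inl 0) • (basisVec 1 * basisVec 2) + q (Sum.inl 1) • (basisVec 2 * basisVec 0) +
      q (Sum.inl 2) • (basisVec 0 * basisVec 1) + q (Sum.inr 0) • 1)

/-- The graph of the isomorphism `α : SU(2) × SU(2) × SU(4) ≅ Spin(4) × Spin(6)`: the pair of spin
group elements acts in the Dirac spinor representations on `Λ ℂ²` and `Λ ℂ³` as the given triple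
acts on `ℂ² ⊗ ℂ ⊕ ℂ ⊗ ℂ²` and on `ℂ⁴ ⊕ ℂ⁴*`. -/
def AlphaRel (a : SU (Fin 2) × SU (Fin 2) × SU4) (x : Spin4 × Spin6) : Prop :=
  (∀ p q : Fin 2 → ℂ, dirac (Fin 2) x.1 (isospinMap p q) =
      isospinMap ((a.1 : Matrix (Fin 2) (Fin 2) ℂ) *ᵥ p)
        ((a.2.1 : Matrix (Fin 2) (Fin 2) ℂ) *ᵥ q)) ∧
  (∀ p q : Fin 3 ⊕ Fin 1 → ℂ, dirac (Fin 3) x.2 (colorMap p q) =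
      colorMap ((a.2.2 : Matrix (Fin 3 ⊕ Fin 1) (Fin 3 ⊕ Fin 1) ℂ) *ᵥ p)
        (((a.2.2⁻¹ : SU4) : Matrix (Fin 3 ⊕ Fin 1) (Fin 3 ⊕ Fin 1) ℂ)ᵀ *ᵥ q))

/-- `θ = α β : G_SM → Spin(4) × Spin(6)`. -/
def IsTheta (θ : GSM →* Spin4 × Spin6) : Prop :=
  ∀ s : GSM, AlphaRel (beta s) (θ s)

end

end GUT

/-! A spin element lying over a unitary matrix `U` acts on the exterior algebra as a scalar `c`
times the map induced by `U`, and `c ^ 2 * U.det = 1`. The pair `(U, c)` determines the element: the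
kernel of the covering is `{1, -1}`, and `c`, read off on the vacuum, fixes the sign
(`IsLift.unique`). Conversely every such pair lifts (`exists_isLift`), since complex reflections
generate the unitary group and lift explicitly. So a unitary representation with a multiplicative
choice of `c` lifts to a homomorphism into the spin group (`exists_liftHom`).

Take `c = 1` on SU(5) to get ψ. For θ take `α³ g` with `c = α⁻³` and `α⁻² h` with `c = α³`;
evaluating these actions degree by degree gives the prescribed one (`alphaRel_of_isLift`). Under η
matrices combine into blocks and vacuum scalars multiply (`isLift_eta`). Since `α⁻³ α³ = 1`, both
ways round the square are the lift of `φ(α, g, h)` with scalar 1, and so they agree.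

An element of both images covers a special unitary matrix that preserves each summand of ℝ⁴ ⊕ ℝ⁶
(`exists_fromBlocks_of_covers_eta`). Such a block matrix is a value of φ, the hypercharge being a
sixth root of the determinant of its first block (`exists_phi_eq_of_blocks`). This gives the
intersection, and with the injectivity of the induced maps it gives the pullback.

ψ is the only lift because lifts agree up to sign and every element of SU(5) is a square; θ is
unique because the Dirac representations are faithful. -/

open scoped Matrix

namespace GUT

noncomputable section

/-! ### Even central elements of a Clifford algebra with an orthogonal basis. -/

section Centre

variable {K M : Type*} [Field K] [AddCommGroup M] [Module K M] {Q : QuadraticForm K M}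

open CliffordAlgebra

theorem involute_mem_adjoin {s : Set M} {a : CliffordAlgebra Q}
    (ha : a ∈ Algebra.adjoin K (ι Q '' s)) : involute a ∈ Algebra.adjoin K (ι Q '' s) := by
  induction ha using Algebra.adjoin_induction with
  | mem x hx =>
    obtain ⟨v, hv, rfl⟩ := hx
    rw [involute_ι]
    exact neg_mem (Algebra.subset_adjoin ⟨v, hv, rfl⟩)
  | algebraMap r =>
    rw [AlgHom.commutes]
    exact Subalgebra.algebraMap_mem _ r
  | add x y _ _ hx hy => simpa using add_mem hx hy
  | mul x y _ _ hx hy => simpa using mul_mem hx hy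

/-- Passing `v` costs one sign per orthogonal generator, and `involute` records exactly these signs.
-/
theorem mul_ι_eq_ι_mul_involute {s : Set M} {v : M} (hv : ∀ w ∈ s, Q.IsOrtho v w)
    {a : CliffordAlgebra Q} (ha : a ∈ Algebra.adjoin K (ι Q '' s)) :
    a * ι Q v = ι Q v * involute a := by
  induction ha using Algebra.adjoin_induction with
  | mem x hx =>
    obtain ⟨w, hw, rfl⟩ := hx
    rw [involute_ι, mul_neg, ι_mul_ι_comm_of_isOrtho (hv w hw), neg_neg]
  | algebraMap r => rw [AlgHom.commutes, Algebra.commutes]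
  | add x y _ _ hx hy => rw [add_mul, hx, hy, map_add, mul_add]
  | mul x y _ _ hx hy => rw [mul_assoc, hy, ← mul_assoc, hx, map_mul, mul_assoc]

/-- In a product, `v` can be moved to the left past the other generators, where `v * v` becomes a
scalar; at most one factor `v` survives. -/
theorem exists_eq_add_ι_mul {s : Set M} {v : M} (hv : ∀ w ∈ s, Q.IsOrtho v w)
    {x : CliffordAlgebra Q} (hx : x ∈ Algebra.adjoin K (ι Q '' insert v s)) :
    ∃ a ∈ Algebra.adjoin K (ι Q '' s), ∃ b ∈ Algebra.adjoin K (ι Q '' s), x = a + ι Q v * b := by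
  induction hx using Algebra.adjoin_induction with
  | mem x hx =>
    obtain ⟨w, rfl | hw, rfl⟩ := hx
    · exact ⟨0, zero_mem _, 1, one_mem _, by simp⟩
    · exact ⟨_, Algebra.subset_adjoin ⟨w, hw, rfl⟩, 0, zero_mem _, by simp⟩
  | algebraMap r => exact ⟨_, Subalgebra.algebraMap_mem _ r, 0, zero_mem _, by simp⟩
  | add x y _ _ hx hy =>
    obtain ⟨a, ha, b, hb, rfl⟩ := hx
    obtain ⟨a', ha', b', hb', rfl⟩ := hy
    exact ⟨_, add_mem ha ha', _, add_mem hb hb', by rw [mul_add]; abel⟩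
  | mul x y _ _ hx hy =>
    obtain ⟨a, ha, b, hb, rfl⟩ := hx
    obtain ⟨a', ha', b', hb', rfl⟩ := hy
    refine ⟨a * a' + Q v • (involute b * b'), add_mem (mul_mem ha ha')
      (Subalgebra.smul_mem _ (mul_mem (involute_mem_adjoin hb) hb') _),
      involute a * b' + b * a', add_mem (mul_mem (involute_mem_adjoin ha) hb') (mul_mem hb ha'), ?_⟩
    have h1 : a * (ι Q v * b') = ι Q v * (involute a * b') := by
      rw [← mul_assoc, mul_ι_eq_ι_mul_involute hv ha, mul_assoc]
    have h2 : ι Q v * b * (ι Q v * b') = Q v • (involute b * b') := by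
      rw [mul_assoc, ← mul_assoc b, mul_ι_eq_ι_mul_involute hv hb, mul_assoc, ← mul_assoc,
        ι_sq_scalar, ← Algebra.smul_def]
    rw [add_mul, mul_add, mul_add, h1, h2, mul_add, mul_assoc]
    abel

/-- Write `x = a + v b`. Evenness gives `involute a - a = v (b + involute b)`, and commuting with
`v` gives `v (involute a - a) = Q v • (b - involute b)`. Together they force `2 • involute b = 0`,
so `b = 0`; uniqueness of the decomposition is not needed. -/
theorem mem_adjoin_of_commute (h2 : (2 : K) ≠ 0) {s : Set M} {v : M}
    (hv : ∀ w ∈ s, Q.IsOrtho v w) (hq : Q v ≠ 0) {x : CliffordAlgebra Q}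
    (hx : x ∈ Algebra.adjoin K (ι Q '' insert v s)) (he : involute x = x)
    (hc : x * ι Q v = ι Q v * x) : x ∈ Algebra.adjoin K (ι Q '' s) := by
  obtain ⟨a, ha, b, hb, rfl⟩ := exists_eq_add_ι_mul hv hx
  have h1 : ι Q v * ι Q v = algebraMap K _ (Q v) := ι_sq_scalar Q v
  have h3 : involute a - a = ι Q v * (b + involute b) := by
    rw [map_add, map_mul, involute_ι, neg_mul] at he
    rw [sub_eq_iff_eq_add, mul_add, ← sub_eq_zero]
    rw [← sub_eq_zero] at he
    rw [← he]
    abel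
  have h4 : ι Q v * (involute a - a) = Q v • (b - involute b) := by
    rw [add_mul, mul_ι_eq_ι_mul_involute hv ha, mul_assoc, mul_ι_eq_ι_mul_involute hv hb, mul_add,
      ← mul_assoc, ← mul_assoc, h1, ← Algebra.smul_def, ← Algebra.smul_def] at hc
    rw [mul_sub, smul_sub, sub_eq_sub_iff_add_eq_add, hc, add_comm]
  rw [h3, ← mul_assoc, h1, ← Algebra.smul_def] at h4
  have h5 : b + involute b = b - involute b := by
    simpa [hq] using congrArg (fun t => (Q v)⁻¹ • t) h4
  have h6 : involute b = 0 := by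
    have : (2 : K) • involute b = 0 := by
      rw [two_smul]
      rw [← sub_eq_zero] at h5
      rw [← h5]
      abel
    simpa [h2] using this
  have h7 : b = 0 := by rw [← involute_involute b, h6, map_zero]
  simpa [h7] using ha

theorem mem_bot_of_commute_finset (h2 : (2 : K) ≠ 0) (s : Finset M)
    (ho : ∀ v ∈ s, ∀ w ∈ s, v ≠ w → Q.IsOrtho v w) (hq : ∀ v ∈ s, Q v ≠ 0)
    {x : CliffordAlgebra Q} (hx : x ∈ Algebra.adjoin K (ι Q '' (s : Set M)))
    (he : involute x = x) (hc : ∀ v ∈ s, x * ι Q v = ι Q v * x) :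
    x ∈ (⊥ : Subalgebra K (CliffordAlgebra Q)) := by
  classical
  induction s using Finset.induction_on with
  | empty => simpa using hx
  | insert v s hvs ih =>
    refine ih (fun a ha b hb => ho a (Finset.mem_insert_of_mem ha) b (Finset.mem_insert_of_mem hb))
      (fun a ha => hq a (Finset.mem_insert_of_mem ha)) ?_
      (fun a ha => hc a (Finset.mem_insert_of_mem ha))
    refine mem_adjoin_of_commute h2 (fun w hw => ho v (Finset.mem_insert_self _ _) w
      (Finset.mem_insert_of_mem hw) ?_) (hq v (Finset.mem_insert_self _ _)) ?_ he
      (hc v (Finset.mem_insert_self _ _))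
    · rintro rfl
      exact hvs hw
    · simpa using hx

end Centre

/-! ### The kernel of the covering of the rotation group. -/

section CSpace

variable {n : Type} [Fintype n]

theorem cliffForm_isOrtho {v w : CSpace n} (h : inner ℝ v w = 0) :
    (cliffForm n).IsOrtho v w := by
  rw [QuadraticMap.isOrtho_def, cliffForm_apply, cliffForm_apply, cliffForm_apply,
    norm_add_sq_real, h]
  ring

theorem cliff_ι_injective : Function.Injective (CliffordAlgebra.ι (cliffForm n)) := by
  rw [injective_iff_map_eq_zero]
  intro v hv
  have h1 := CliffordAlgebra.ι_sq_scalar (cliffForm n) v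
  rw [hv, zero_mul, eq_comm, FaithfulSMul.algebraMap_eq_zero_iff, cliffForm_apply] at h1
  simpa using h1

/-- The even part of the centre of the Clifford algebra consists of the scalars. -/
theorem exists_eq_algebraMap_of_commute {x : Cliff n} (he : CliffordAlgebra.involute x = x)
    (hc : ∀ v, x * CliffordAlgebra.ι (cliffForm n) v = CliffordAlgebra.ι (cliffForm n) v * x) :
    ∃ r : ℝ, x = algebraMap ℝ (Cliff n) r := by
  classical
  let b := stdOrthonormalBasis ℝ (CSpace n)
  have hx : x ∈ Algebra.adjoin ℝ (CliffordAlgebra.ι (cliffForm n) ''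
      ((Finset.univ.image b : Finset (CSpace n)) : Set (CSpace n))) := by
    have : (⊤ : Subalgebra ℝ (Cliff n)) ≤ Algebra.adjoin ℝ (CliffordAlgebra.ι (cliffForm n) ''
        ((Finset.univ.image b : Finset (CSpace n)) : Set (CSpace n))) := by
      rw [← CliffordAlgebra.adjoin_range_ι, Algebra.adjoin_le_iff]
      rintro _ ⟨v, rfl⟩
      rw [SetLike.mem_coe, ← b.sum_repr v, map_sum]
      refine sum_mem fun i _ => ?_
      rw [map_smul]
      exact Subalgebra.smul_mem _ (Algebra.subset_adjoin (Set.mem_image_of_mem _ (by simp))) _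
    exact this trivial
  have := mem_bot_of_commute_finset (Q := cliffForm n) two_ne_zero (Finset.univ.image b)
    (by
      intro v hv w hw hvw
      simp only [Finset.mem_image, Finset.mem_univ, true_and] at hv hw
      obtain ⟨i, rfl⟩ := hv
      obtain ⟨j, rfl⟩ := hw
      refine cliffForm_isOrtho (b.orthonormal.2 ?_)
      rintro rfl
      exact hvw rfl)
    (by
      intro v hv
      simp only [Finset.mem_image, Finset.mem_univ, true_and] at hv
      obtain ⟨i, rfl⟩ := hv
      rw [cliffForm_apply, b.orthonormal.1]
      norm_num) hx he (fun v _ => hc v)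
  obtain ⟨r, hr⟩ := Algebra.mem_bot.1 this
  exact ⟨r, hr.symm⟩

theorem spin_coe_inv (x : Spin n) : ((x⁻¹ : Spin n) : Cliff n) = star (x : Cliff n) := rfl

theorem spin_mul_inv (x : Spin n) : (x : Cliff n) * ((x⁻¹ : Spin n) : Cliff n) = 1 :=
  spinGroup.mul_star_self_of_mem x.2

theorem spin_inv_mul (x : Spin n) : ((x⁻¹ : Spin n) : Cliff n) * (x : Cliff n) = 1 :=
  spinGroup.star_mul_self_of_mem x.2

/-- The kernel of the covering map `Spin(2n) → SO(2n)` is `{1, -1}`. -/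
theorem spin_eq_one_or_neg_one_of_commute (x : Spin n)
    (hc : ∀ v, (x : Cliff n) * CliffordAlgebra.ι (cliffForm n) v =
      CliffordAlgebra.ι (cliffForm n) v * x) : (x : Cliff n) = 1 ∨ (x : Cliff n) = -1 := by
  obtain ⟨r, hr⟩ := exists_eq_algebraMap_of_commute (spinGroup.involute_eq x.2) hc
  have h := spin_mul_inv x
  rw [spin_coe_inv, hr, CliffordAlgebra.star_algebraMap, ← map_mul,
    ← map_one (algebraMap ℝ (Cliff n)), (FaithfulSMul.algebraMap_injective ℝ (Cliff n)).eq_iff,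
    mul_self_eq_one_iff] at h
  rcases h with rfl | rfl
  · left; rw [hr, map_one]
  · right; rw [hr, map_neg, map_one]

/-- A spin group element acts on vectors by conjugation. -/
theorem spin_exists_conj (x : Spin n) (v : CSpace n) :
    ∃ w, (x : Cliff n) * CliffordAlgebra.ι (cliffForm n) v * ((x⁻¹ : Spin n) : Cliff n) =
      CliffordAlgebra.ι (cliffForm n) w := by
  obtain ⟨w, hw⟩ := spinGroup.conjAct_smul_ι_mem_range_ι (x := spinGroup.toUnits x) x.2 v
  exact ⟨w, hw.symm⟩

theorem spin_conj_eq_iff (x : Spin n) (a b : Cliff n) :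
    (x : Cliff n) * a * ((x⁻¹ : Spin n) : Cliff n) = b ↔ (x : Cliff n) * a = b * x := by
  constructor
  · rintro rfl
    rw [mul_assoc, spin_inv_mul, mul_one]
  · intro h
    rw [h, mul_assoc, spin_mul_inv, mul_one]

end CSpace

/-! ### Creation operators from Clifford multiplication. -/

section Dirac

variable {n : Type} [Fintype n]

theorem dirac_apply (x : Spin n) : dirac n x = cliffAct n (x : Cliff n) := rfl

theorem cliffAct_ι (v : CSpace n) :
    cliffAct n (CliffordAlgebra.ι (cliffForm n) v) = gammaOp n v :=
  CliffordAlgebra.lift_ι_apply _ _ _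

theorem gammaOp_apply (v : CSpace n) (ω : Ext n) :
    gammaOp n v ω = Complex.I • (annihilation v ω + ExteriorAlgebra.ι ℂ v * ω) := rfl

theorem annihilation_smul (z : ℂ) (v : CSpace n) (ω : Ext n) :
    annihilation (z • v) ω = star z • annihilation v ω := by
  have h : innerₛₗ ℂ (z • v) = star z • innerₛₗ ℂ v := by
    rw [LinearMap.map_smulₛₗ]
    rfl
  rw [annihilation, h, map_smul]
  rfl

/-- Creation is linear in `v` and annihilation is conjugate linear, so combining the operators of
`v` and `i v` cancels annihilation. -/
theorem ι_mul_eq_gammaOp (v : CSpace n) (ω : Ext n) :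
    ExteriorAlgebra.ι ℂ v * ω =
      (-(1 / 2 : ℂ)) • (Complex.I • gammaOp n v ω + gammaOp n (Complex.I • v) ω) := by
  rw [gammaOp_apply, gammaOp_apply, annihilation_smul, map_smul, smul_mul_assoc, smul_smul,
    Complex.I_mul_I, smul_add Complex.I, smul_smul, smul_smul, Complex.I_mul_I]
  simp only [Complex.star_def, Complex.conj_I, mul_neg, Complex.I_mul_I, neg_neg]
  module

end Dirac

/-! ### Spin elements over complex linear rotations. -/

section Lift

variable {n : Type} [Fintype n] [DecidableEq n]

theorem act_apply_ofLp (A : Matrix n n ℂ) (v : CSpace n) : (act A v).ofLp = A *ᵥ v.ofLp := rfl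

theorem act_mul (A B : Matrix n n ℂ) (v : CSpace n) : act (A * B) v = act A (act B v) := by
  apply WithLp.ofLp_injective
  simp [Matrix.mulVec_mulVec]

theorem act_one (v : CSpace n) : act (1 : Matrix n n ℂ) v = v := by
  apply WithLp.ofLp_injective
  simp

theorem act_injective {A B : Matrix n n ℂ} (h : ∀ v, act A v = act B v) : A = B :=
  Matrix.toEuclideanLin.injective (LinearMap.ext h)

theorem inner_act_act {U : Matrix n n ℂ} (hU : U ∈ Matrix.unitaryGroup n ℂ) (v w : CSpace n) :
    inner ℂ (act U v) (act U w) = inner ℂ v w := by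
  have h : star U * U = 1 := Matrix.mem_unitaryGroup_iff'.1 hU
  rw [EuclideanSpace.inner_eq_star_dotProduct, EuclideanSpace.inner_eq_star_dotProduct,
    act_apply_ofLp, act_apply_ofLp, Matrix.star_mulVec, dotProduct_comm,
    ← Matrix.dotProduct_mulVec, Matrix.mulVec_mulVec, ← Matrix.star_eq_conjTranspose, h,
    Matrix.one_mulVec, dotProduct_comm]

theorem coversRotation_iff {x : Spin n} {A : Matrix n n ℂ} :
    CoversRotation x A ↔ ∀ v : CSpace n, (x : Cliff n) * CliffordAlgebra.ι (cliffForm n) v =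
      CliffordAlgebra.ι (cliffForm n) (act A v) * x :=
  forall_congr' fun _ => spin_conj_eq_iff x _ _

theorem CoversRotation.mul {x y : Spin n} {A B : Matrix n n ℂ} (hx : CoversRotation x A)
    (hy : CoversRotation y B) : CoversRotation (x * y) (A * B) := by
  rw [coversRotation_iff] at *
  intro v
  rw [Submonoid.coe_mul, mul_assoc, hy, ← mul_assoc, hx, mul_assoc, act_mul]

theorem CoversRotation.one : CoversRotation (1 : Spin n) (1 : Matrix n n ℂ) := by
  rw [coversRotation_iff]
  intro v
  rw [act_one, Submonoid.coe_one, one_mul, mul_one]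

theorem CoversRotation.neg [Nonempty n] {x : Spin n} {A : Matrix n n ℂ} (hx : CoversRotation x A) :
    CoversRotation (spinNegOne n * x) A := by
  rw [coversRotation_iff] at *
  intro v
  simp [spinNegOne, hx v]

theorem CoversRotation.matrix_eq {x : Spin n} {A B : Matrix n n ℂ} (hA : CoversRotation x A)
    (hB : CoversRotation x B) : A = B :=
  act_injective fun v => cliff_ι_injective ((hA v).symm.trans (hB v))

/-- Two spin group elements over the same rotation agree up to sign. -/
theorem CoversRotation.eq_or_eq_neg {x y : Spin n} {A : Matrix n n ℂ} (hx : CoversRotation x A)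
    (hy : CoversRotation y A) : (x : Cliff n) = y ∨ (x : Cliff n) = -y := by
  have hc : ∀ v, ((y⁻¹ * x : Spin n) : Cliff n) * CliffordAlgebra.ι (cliffForm n) v =
      CliffordAlgebra.ι (cliffForm n) v * ((y⁻¹ * x : Spin n) : Cliff n) := by
    intro v
    have h1 := coversRotation_iff.1 hx v
    have h2 := coversRotation_iff.1 hy v
    have h3 : CliffordAlgebra.ι (cliffForm n) v * ((y⁻¹ : Spin n) : Cliff n) =
        ((y⁻¹ : Spin n) : Cliff n) * CliffordAlgebra.ι (cliffForm n) (act A v) := by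
      have := congrArg (fun t => ((y⁻¹ : Spin n) : Cliff n) * t * ((y⁻¹ : Spin n) : Cliff n)) h2
      simp only [← mul_assoc, spin_inv_mul, one_mul] at this
      rw [this, mul_assoc, spin_mul_inv, mul_one]
    rw [Submonoid.coe_mul, mul_assoc, h1, ← mul_assoc, ← h3, mul_assoc]
  have key : (x : Cliff n) = y * ((y⁻¹ * x : Spin n) : Cliff n) := by
    rw [Submonoid.coe_mul, ← mul_assoc, spin_mul_inv, one_mul]
  rcases spin_eq_one_or_neg_one_of_commute _ hc with h | h
  · left; rw [key, h, mul_one]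
  · right; rw [key, h, mul_neg_one]

theorem CoversRotation.dirac_gammaOp {x : Spin n} {A : Matrix n n ℂ} (hx : CoversRotation x A)
    (v : CSpace n) (ω : Ext n) :
    dirac n x (gammaOp n v ω) = gammaOp n (act A v) (dirac n x ω) := by
  have h := congrArg (cliffAct n) (coversRotation_iff.1 hx v)
  rw [map_mul, map_mul, cliffAct_ι, cliffAct_ι] at h
  exact LinearMap.congr_fun h ω

/-- Complex linearity of the rotation enters here: it takes `i v` to `i` times the image of `v`, so
the formula for the creation operator is carried along. -/
theorem CoversRotation.dirac_ι_mul {x : Spin n} {A : Matrix n n ℂ} (hx : CoversRotation x A)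
    (v : CSpace n) (ω : Ext n) :
    dirac n x (ExteriorAlgebra.ι ℂ v * ω) = ExteriorAlgebra.ι ℂ (act A v) * dirac n x ω := by
  rw [ι_mul_eq_gammaOp, ι_mul_eq_gammaOp, map_smul, map_add, map_smul, hx.dirac_gammaOp,
    hx.dirac_gammaOp, map_smul]

/-- `IsLift x A c` says that `x` lies over the rotation given by `A` and multiplies the vacuum
vector of `Λ ℂⁿ` by `c`; it then acts on `Λ ℂⁿ` as `c` times the map induced by `A`. -/
structure IsLift (x : Spin n) (A : Matrix n n ℂ) (c : ℂ) : Prop where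
  covers : CoversRotation x A
  vacuum : dirac n x 1 = c • 1

theorem IsLift.mul {x y : Spin n} {A B : Matrix n n ℂ} {c d : ℂ} (hx : IsLift x A c)
    (hy : IsLift y B d) : IsLift (x * y) (A * B) (c * d) where
  covers := hx.covers.mul hy.covers
  vacuum := by
    rw [map_mul, Module.End.mul_apply, hy.vacuum, map_smul, hx.vacuum, smul_smul, mul_comm]

theorem IsLift.one : IsLift (1 : Spin n) 1 1 where
  covers := CoversRotation.one
  vacuum := by rw [map_one (dirac n), Module.End.one_apply, one_smul]

theorem IsLift.neg [Nonempty n] {x : Spin n} {A : Matrix n n ℂ} {c : ℂ} (hx : IsLift x A c) :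
    IsLift (spinNegOne n * x) A (-c) where
  covers := hx.covers.neg
  vacuum := by
    have h : dirac n (spinNegOne n) = -1 := by
      rw [dirac_apply, spinNegOne, map_neg, map_one]
    rw [map_mul, Module.End.mul_apply, hx.vacuum, h]
    simp

/-- The elements agree up to sign, and the opposite sign would turn the nonzero vacuum scalar `c`
into `-c`. -/
theorem IsLift.unique {x y : Spin n} {A : Matrix n n ℂ} {c : ℂ} (hc : c ≠ 0) (hx : IsLift x A c)
    (hy : IsLift y A c) : x = y := by
  apply Subtype.ext
  rcases hx.covers.eq_or_eq_neg hy.covers with h | h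
  · exact h
  · exfalso
    have h1 := hx.vacuum
    rw [dirac_apply, h, map_neg, ← dirac_apply, LinearMap.neg_apply, hy.vacuum, ← neg_smul] at h1
    have h2 := smul_left_injective ℂ (one_ne_zero (α := Ext n)) h1
    exact hc (by linear_combination (-1 / 2 : ℂ) * h2)

end Lift

/-! ### Explicit lifts of complex reflections. -/

section Reflection

variable {n : Type} [Fintype n]

theorem ι_mul_ι_mem_spin {e f : CSpace n} (he : ‖e‖ = 1) (hf : ‖f‖ = 1) :
    CliffordAlgebra.ι (cliffForm n) e * CliffordAlgebra.ι (cliffForm n) f ∈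
      spinGroup (cliffForm n) := by
  have hsq : ∀ v : CSpace n, ‖v‖ = 1 → CliffordAlgebra.ι (cliffForm n) v *
      CliffordAlgebra.ι (cliffForm n) v = -1 := by
    intro v hv
    rw [CliffordAlgebra.ι_sq_scalar, cliffForm_apply, hv, one_pow, map_neg, map_one]
  let u : ∀ v : CSpace n, ‖v‖ = 1 → (Cliff n)ˣ := fun v hv =>
    ⟨CliffordAlgebra.ι (cliffForm n) v, -CliffordAlgebra.ι (cliffForm n) v,
      by simp [hsq v hv], by simp [hsq v hv]⟩
  have hu : ∀ v hv, u v hv ∈ lipschitzGroup (cliffForm n) :=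
    fun v hv => Subgroup.subset_closure ⟨_, rfl⟩
  refine ⟨⟨⟨u e he * u f hf, mul_mem (hu e he) (hu f hf), rfl⟩, ?_⟩, ?_⟩
  · rw [SetLike.mem_coe, Unitary.mem_iff]
    simp only [star_mul, CliffordAlgebra.star_ι, neg_mul, mul_neg, neg_neg]
    constructor
    · rw [mul_assoc, ← mul_assoc (CliffordAlgebra.ι (cliffForm n) e), hsq e he, neg_one_mul,
        mul_neg, hsq f hf, neg_neg]
    · rw [mul_assoc, ← mul_assoc (CliffordAlgebra.ι (cliffForm n) f), hsq f hf, neg_one_mul,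
        mul_neg, hsq e he, neg_neg]
  · exact CliffordAlgebra.ι_mul_ι_mem_evenOdd_zero (cliffForm n) e f

/-- The spin group element `a + b e (i e)`, where `u = a + i b` has modulus one. -/
def reflSpin (e : CSpace n) (u : ℂ) (he : ‖e‖ = 1) (hu : ‖u‖ = 1) : Spin n :=
  -- With `u = a + i b` the second unit vector is `-a e + b (i e)`; since `e * e = -1`, its product
  -- with `e` is `a + b e (i e)`.
  ⟨_, ι_mul_ι_mem_spin (e := e) (f := (-star u) • e) he
    (by rw [norm_smul, norm_neg, norm_star, hu, he, one_mul])⟩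

theorem complex_smul_eq (z : ℂ) (e : CSpace n) :
    z • e = z.re • e + z.im • (Complex.I • e) := by
  ext i
  simp [← add_mul, ← mul_assoc]

theorem reflSpin_coe (e : CSpace n) (u : ℂ) (he : ‖e‖ = 1) (hu : ‖u‖ = 1) :
    (reflSpin e u he hu : Cliff n) = algebraMap ℝ _ u.re +
      u.im • (CliffordAlgebra.ι (cliffForm n) e *
        CliffordAlgebra.ι (cliffForm n) (Complex.I • e)) := by
  change CliffordAlgebra.ι (cliffForm n) e * CliffordAlgebra.ι (cliffForm n) ((-star u) • e) = _
  rw [complex_smul_eq (-star u), map_add, map_smul, map_smul, mul_add, mul_smul_comm,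
    mul_smul_comm, CliffordAlgebra.ι_sq_scalar, cliffForm_apply, he]
  simp [Algebra.algebraMap_eq_smul_one]

variable [DecidableEq n]

/-- The matrix of the complex reflection `v ↦ v + (z - 1) ⟨e, v⟩ e`. -/
def reflMatrix (e : CSpace n) (z : ℂ) : Matrix n n ℂ :=
  1 + Matrix.vecMulVec ((z - 1) • e.ofLp) (star e.ofLp)

theorem act_reflMatrix (e : CSpace n) (z : ℂ) (v : CSpace n) :
    act (reflMatrix e z) v = v + ((z - 1) * inner ℂ e v) • e := by
  apply WithLp.ofLp_injective
  rw [act_apply_ofLp, reflMatrix, Matrix.add_mulVec, Matrix.one_mulVec, Matrix.vecMulVec_mulVec,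
    EuclideanSpace.inner_eq_star_dotProduct]
  ext i
  simp [dotProduct_comm]
  ring

theorem det_reflMatrix (e : CSpace n) (z : ℂ) (he : ‖e‖ = 1) : (reflMatrix e z).det = z := by
  have h : star e.ofLp ⬝ᵥ e.ofLp = 1 := by
    rw [dotProduct_comm, ← EuclideanSpace.inner_eq_star_dotProduct, inner_self_eq_norm_sq_to_K, he]
    simp
  rw [reflMatrix, Matrix.vecMulVec_eq Unit, Matrix.det_one_add_replicateCol_mul_replicateRow,
    dotProduct_smul, h]
  simp

theorem conjTranspose_reflMatrix (e : CSpace n) (z : ℂ) :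
    (reflMatrix e z)ᴴ = reflMatrix e (star z) := by
  ext i j
  simp only [reflMatrix, Matrix.conjTranspose_apply, Matrix.add_apply, Matrix.vecMulVec_apply,
    Pi.smul_apply, smul_eq_mul, Pi.star_apply, star_add, star_mul', star_sub, star_one, star_star,
    Matrix.one_apply, eq_comm (a := j), apply_ite (star : ℂ → ℂ), star_zero]
  ring

theorem reflMatrix_mul (e : CSpace n) (z w : ℂ) (he : ‖e‖ = 1) :
    reflMatrix e z * reflMatrix e w = reflMatrix e (z * w) := by
  refine act_injective fun v => ?_
  rw [act_mul, act_reflMatrix, act_reflMatrix, act_reflMatrix, inner_add_right, inner_smul_right,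
    inner_self_eq_norm_sq_to_K, he, RCLike.ofReal_one, one_pow, mul_one]
  module

theorem reflMatrix_one (e : CSpace n) : reflMatrix e 1 = 1 := by
  simp [reflMatrix]

theorem reflMatrix_mem (e : CSpace n) (z : ℂ) (he : ‖e‖ = 1) (hz : ‖z‖ = 1) :
    reflMatrix e z ∈ Matrix.unitaryGroup n ℂ := by
  rw [Matrix.mem_unitaryGroup_iff, Matrix.star_eq_conjTranspose, conjTranspose_reflMatrix,
    reflMatrix_mul e _ _ he, Complex.star_def, Complex.mul_conj, Complex.normSq_eq_norm_sq, hz]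
  simp [reflMatrix_one]

/-- On the line `ℂ e`, left multiplication by the spin element multiplies the coefficient by `u` and
right multiplication by `star u`, so conjugation rotates by `u ^ 2`. Vectors orthogonal to the line
anticommute with both `e` and `i e`, and hence commute with the element. On the vacuum `e (i e)`
acts as `-i`, whence the scalar `star u`. -/
theorem isLift_reflSpin (e : CSpace n) (u : ℂ) (he : ‖e‖ = 1) (hu : ‖u‖ = 1) :
    IsLift (reflSpin e u he hu) (reflMatrix e (u ^ 2)) (star u) := by
  set E := CliffordAlgebra.ι (cliffForm n) e with hE
  set F := CliffordAlgebra.ι (cliffForm n) (Complex.I • e) with hF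
  have hEE : E * E = -1 := by
    rw [CliffordAlgebra.ι_sq_scalar, cliffForm_apply, he, one_pow, map_neg, map_one]
  have hFF : F * F = -1 := by
    rw [CliffordAlgebra.ι_sq_scalar, cliffForm_apply, norm_smul, he, Complex.norm_I, one_mul,
      one_pow, map_neg, map_one]
  have horth : ∀ v w : CSpace n, inner ℂ v w = 0 → (cliffForm n).IsOrtho v w := by
    intro v w h
    rw [QuadraticMap.isOrtho_def, cliffForm_apply, cliffForm_apply, cliffForm_apply,
      norm_add_sq (𝕜 := ℂ), h]
    simp
    ring
  have hFE : F * E = -(E * F) := by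
    refine CliffordAlgebra.ι_mul_ι_comm_of_isOrtho ?_
    have h : Complex.I • e + e = (Complex.I + 1) • e := by rw [add_smul, one_smul]
    have h' : ‖Complex.I + 1‖ ^ 2 = 2 := by
      rw [← Complex.normSq_eq_norm_sq, Complex.normSq_apply]
      norm_num
    rw [QuadraticMap.isOrtho_def, cliffForm_apply, cliffForm_apply, cliffForm_apply, h, norm_smul,
      norm_smul, he, mul_one, h', Complex.norm_I]
    norm_num
  have hx : (reflSpin e u he hu : Cliff n) = algebraMap ℝ _ u.re + u.im • (E * F) :=
    reflSpin_coe e u he hu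
  have h1 : ∀ l : ℂ, CliffordAlgebra.ι (cliffForm n) (l • e) = l.re • E + l.im • F := by
    intro l
    rw [complex_smul_eq, map_add, map_smul, map_smul]
  have hEFE : E * F * E = F := by rw [mul_assoc, hFE, mul_neg, ← mul_assoc, hEE]; simp
  have hEFF : E * F * F = -E := by rw [mul_assoc, hFF]; simp
  have hEEF : E * (E * F) = -F := by rw [← mul_assoc, hEE]; simp
  have hFEF : F * (E * F) = E := by rw [← mul_assoc, hFE, neg_mul, hEFF, neg_neg]
  have hmul : ∀ l : ℂ, (reflSpin e u he hu : Cliff n) * CliffordAlgebra.ι (cliffForm n) (l • e) =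
      CliffordAlgebra.ι (cliffForm n) ((u * l) • e) := by
    intro l
    rw [hx, h1, h1, Algebra.algebraMap_eq_smul_one]
    simp only [add_mul, mul_add, smul_mul_assoc, mul_smul_comm, one_mul, hEFE, hEFF, Complex.mul_re,
      Complex.mul_im]
    module
  have hmul' : ∀ l : ℂ, CliffordAlgebra.ι (cliffForm n) (l • e) * (reflSpin e u he hu : Cliff n) =
      CliffordAlgebra.ι (cliffForm n) ((star u * l) • e) := by
    intro l
    rw [hx, h1, h1, Algebra.algebraMap_eq_smul_one]
    simp only [add_mul, mul_add, smul_mul_assoc, mul_smul_comm, mul_one, hEEF, hFEF, Complex.mul_re,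
      Complex.mul_im, Complex.star_def, Complex.conj_re, Complex.conj_im]
    module
  have hus : star u * u = 1 := by
    rw [mul_comm, Complex.star_def, Complex.mul_conj, Complex.normSq_eq_norm_sq, hu]
    simp
  refine ⟨coversRotation_iff.2 fun v => ?_, ?_⟩
  · set l := inner ℂ e v with hl
    have hw : inner ℂ e (v - l • e) = 0 := by
      rw [inner_sub_right, inner_smul_right, inner_self_eq_norm_sq_to_K, he, ← hl]
      simp
    have hw' : inner ℂ (Complex.I • e) (v - l • e) = 0 := by
      rw [inner_smul_left, hw, mul_zero]
    have hcE := CliffordAlgebra.ι_mul_ι_comm_of_isOrtho (horth _ _ hw)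
    have hcF := CliffordAlgebra.ι_mul_ι_comm_of_isOrtho (horth _ _ hw')
    rw [← hE] at hcE
    rw [← hF] at hcF
    have hc : (reflSpin e u he hu : Cliff n) * CliffordAlgebra.ι (cliffForm n) (v - l • e) =
        CliffordAlgebra.ι (cliffForm n) (v - l • e) * (reflSpin e u he hu : Cliff n) := by
      rw [hx, add_mul, mul_add, Algebra.commutes, smul_mul_assoc, mul_smul_comm, mul_assoc E, hcF,
        mul_neg, ← mul_assoc E, hcE, neg_mul, neg_neg, mul_assoc]
    have hv : act (reflMatrix e (u ^ 2)) v = (u * (u * l)) • e + (v - l • e) := by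
      rw [act_reflMatrix, ← hl]
      module
    have hv' : v = l • e + (v - l • e) := by abel
    rw [hv, map_add, add_mul, ← hc, hmul', ← mul_assoc, hus, one_mul, ← hmul, ← mul_add, ← map_add,
      ← hv']
  · have hI : dirac n (reflSpin e u he hu) 1 =
        (u.re : ℂ) • (1 : Ext n) + (u.im : ℂ) • gammaOp n e (gammaOp n (Complex.I • e) 1) := by
      rw [dirac_apply, reflSpin_coe, map_add, AlgHom.commutes, map_smul, map_mul, cliffAct_ι,
        cliffAct_ι, LinearMap.add_apply, LinearMap.smul_apply, Module.algebraMap_end_apply,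
        Module.End.mul_apply, Complex.coe_smul, Complex.coe_smul]
    have ha : ∀ v : CSpace n, annihilation v (1 : Ext n) = 0 :=
      fun v => CliffordAlgebra.contractLeft_one (Q := 0) _
    have hb : annihilation e (ExteriorAlgebra.ι ℂ e) = 1 := by
      have h0 : innerₛₗ ℂ e e = 1 := by
        rw [innerₛₗ_apply_apply, inner_self_eq_norm_sq_to_K, he]
        simp
      have : annihilation e (ExteriorAlgebra.ι ℂ e) = algebraMap ℂ _ (innerₛₗ ℂ e e) :=
        CliffordAlgebra.contractLeft_ι _ _ _
      rw [this, h0, map_one]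
    rw [hI, gammaOp_apply (Complex.I • e), ha, zero_add, mul_one,
      map_smul (ExteriorAlgebra.ι ℂ), smul_smul, Complex.I_mul_I, map_smul, gammaOp_apply, hb,
      ExteriorAlgebra.ι_sq_zero, add_zero]
    simp only [smul_smul, ← add_smul]
    congr 1
    apply Complex.ext <;> simp

end Reflection

/-! ### Generation by reflections, and lifting of unitary representations. -/

section Generation

variable {n : Type} [Fintype n] [DecidableEq n]

/-- The subspace of vectors fixed by a matrix. -/
def fixedSpace (A : Matrix n n ℂ) : Submodule ℂ (CSpace n) := LinearMap.ker (act A - LinearMap.id)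

theorem mem_fixedSpace {A : Matrix n n ℂ} {v : CSpace n} : v ∈ fixedSpace A ↔ act A v = v := by
  rw [fixedSpace, LinearMap.mem_ker, LinearMap.sub_apply, LinearMap.id_apply, sub_eq_zero]

theorem act_conjTranspose_act {U : Matrix n n ℂ} (hU : U ∈ Matrix.unitaryGroup n ℂ)
    (v : CSpace n) : act Uᴴ (act U v) = v := by
  rw [← act_mul, ← Matrix.star_eq_conjTranspose, Matrix.mem_unitaryGroup_iff'.1 hU, act_one]

/-- A unitary matrix that moves `v` agrees at `v` with a complex reflection that fixes every vector
the matrix fixes. -/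
theorem exists_reflMatrix {U : Matrix n n ℂ} (hU : U ∈ Matrix.unitaryGroup n ℂ) {v : CSpace n}
    (hv : act U v ≠ v) : ∃ (e : CSpace n) (z : ℂ), ‖e‖ = 1 ∧ ‖z‖ = 1 ∧
      act (reflMatrix e z) v = act U v ∧ ∀ w, act U w = w → act (reflMatrix e z) w = w := by
  set d := v - act U v with hd
  have hd0 : d ≠ 0 := sub_ne_zero.2 hv.symm
  have hn : (‖d‖ : ℂ) ≠ 0 := by simpa using hd0
  set p := inner ℂ d v with hp
  -- As `U` preserves norms, `‖d‖ ^ 2` is twice the real part of `⟨d, v⟩`; so `p` is nonzero and may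
  -- be divided by.
  have hsum : (‖d‖ : ℂ) ^ 2 = p + star p := by
    have h1 : inner ℂ d d = p - inner ℂ d (act U v) := by rw [← inner_sub_right]
    have h2 : inner ℂ d (act U v) = - inner ℂ v d := by
      rw [hd, inner_sub_left, inner_sub_right, inner_act_act hU]
      ring
    have h3 : inner ℂ v d = star p := (inner_conj_symm v d).symm
    rw [inner_self_eq_norm_sq_to_K, h2, h3, sub_neg_eq_add] at h1
    exact h1
  have hp0 : p ≠ 0 := by
    intro h
    rw [h, star_zero, add_zero] at hsum
    exact hn (pow_eq_zero_iff two_ne_zero |>.1 hsum)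
  -- The value of `z` solves `(z - 1) * p / ‖d‖ ^ 2 = -1`, which says that the reflection takes `v`
  -- to `v - d`.
  refine ⟨(‖d‖ : ℂ)⁻¹ • d, -star p / p, ?_, ?_, ?_, ?_⟩
  · rw [norm_smul, norm_inv, Complex.norm_real, norm_norm, inv_mul_cancel₀ (by simpa using hd0)]
  · rw [norm_div, norm_neg, norm_star, div_self (by simpa using hp0)]
  · rw [act_reflMatrix, inner_smul_left, ← hp, smul_smul, map_inv₀, Complex.conj_ofReal]
    have : (-star p / p - 1) * ((‖d‖ : ℂ)⁻¹ * p) * (‖d‖ : ℂ)⁻¹ = -1 := by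
      field_simp
      rw [hsum]
      ring
    rw [this, hd]
    module
  · intro w hw
    -- A vector fixed by `U` is orthogonal to `v - U v`, because `⟨U v, w⟩ = ⟨U v, U w⟩ = ⟨v, w⟩`.
    have h : inner ℂ d w = 0 := by
      rw [hd, inner_sub_left, sub_eq_zero]
      nth_rewrite 2 [← hw]
      rw [inner_act_act hU]
    rw [act_reflMatrix, inner_smul_left, h]
    simp

/-- The unitary group is generated by complex reflections. -/
theorem unitary_induction {P : Matrix n n ℂ → Prop} (one : P 1)
    (refl : ∀ e z A, ‖e‖ = 1 → ‖z‖ = 1 → A ∈ Matrix.unitaryGroup n ℂ → P A →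
      P (reflMatrix e z * A))
    {U : Matrix n n ℂ} (hU : U ∈ Matrix.unitaryGroup n ℂ) : P U := by
  -- The induction is on the codimension of the fixed space; undoing one reflection keeps the fixed
  -- vectors and adds `v`.
  induction h : Module.finrank ℂ (CSpace n) - Module.finrank ℂ (fixedSpace U)
    using Nat.strong_induction_on generalizing U with
  | _ k ih =>
    by_cases h1 : ∀ v, act U v = v
    · rw [act_injective fun v => (h1 v).trans (act_one v).symm]
      exact one
    push Not at h1
    obtain ⟨v, hv⟩ := h1
    obtain ⟨e, z, he, hz, hev, hfix⟩ := exists_reflMatrix hU hv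
    have hR := reflMatrix_mem e z he hz
    have hR' : (reflMatrix e z)ᴴ ∈ Matrix.unitaryGroup n ℂ := Unitary.star_mem hR
    have hUR : U = reflMatrix e z * ((reflMatrix e z)ᴴ * U) := by
      rw [← mul_assoc, ← Matrix.star_eq_conjTranspose, Matrix.mem_unitaryGroup_iff.1 hR, one_mul]
    have hlt : fixedSpace U < fixedSpace ((reflMatrix e z)ᴴ * U) := by
      rw [SetLike.lt_iff_le_and_exists]
      refine ⟨fun w hw => ?_, v, ?_, ?_⟩
      · rw [mem_fixedSpace] at *
        rw [act_mul, hw]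
        nth_rewrite 1 [← hfix w hw]
        exact act_conjTranspose_act hR w
      · rw [mem_fixedSpace, act_mul, ← hev, act_conjTranspose_act hR]
      · rwa [mem_fixedSpace]
    rw [hUR]
    refine refl e z _ he hz (mul_mem hR' hU) (ih _ ?_ (mul_mem hR' hU) rfl)
    have := Submodule.finrank_lt_finrank_of_lt hlt
    have := Submodule.finrank_le (fixedSpace ((reflMatrix e z)ᴴ * U))
    omega

/-- A reflection with parameter `u ^ 2` has determinant `u ^ 2` and vacuum scalar `star u`, so the
relation holds for the generators and is multiplicative. -/
theorem exists_isLift_sq {U : Matrix n n ℂ} (hU : U ∈ Matrix.unitaryGroup n ℂ) :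
    ∃ x c, IsLift x U c ∧ c ^ 2 * U.det = 1 := by
  refine unitary_induction (P := fun U => ∃ x c, IsLift x U c ∧ c ^ 2 * U.det = 1)
    ⟨1, 1, IsLift.one, by simp⟩ ?_ hU
  · rintro e z A he hz - ih
    obtain ⟨x, c, hx, hc⟩ := ih
    obtain ⟨u, rfl⟩ := IsAlgClosed.exists_pow_nat_eq z two_pos
    have hu : ‖u‖ = 1 := by
      rw [norm_pow] at hz
      exact (pow_eq_one_iff_of_nonneg (norm_nonneg u) two_ne_zero).1 hz
    refine ⟨_, _, (isLift_reflSpin e u he hu).mul hx, ?_⟩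
    have hus : star u * u = 1 := by
      rw [mul_comm, Complex.star_def, Complex.mul_conj, Complex.normSq_eq_norm_sq, hu]
      simp
    rw [Matrix.det_mul, det_reflMatrix e _ he]
    linear_combination (star u * u) ^ 2 * hc + (star u * u + 1) * hus

/-- A unitary matrix `U`, together with a square root `c` of `(det U)⁻¹`, lifts to the spin
group. -/
theorem exists_isLift [Nonempty n] {U : Matrix n n ℂ} (hU : U ∈ Matrix.unitaryGroup n ℂ) {c : ℂ}
    (hc : c ^ 2 * U.det = 1) : ∃ x, IsLift x U c := by
  obtain ⟨x, d, hx, hd⟩ := exists_isLift_sq hU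
  have hdet : U.det ≠ 0 := right_ne_zero_of_mul_eq_one hc
  -- The scalar found is `c` or `-c`, and multiplying by the spin element `-1` repairs the sign.
  rcases sq_eq_sq_iff_eq_or_eq_neg.1 (mul_right_cancel₀ hdet (hc.trans hd.symm)) with rfl | rfl
  · exact ⟨x, hx⟩
  · exact ⟨_, hx.neg⟩

/-- A unitary representation with a chosen square root of the inverse determinant lifts to a
homomorphism to the spin group. -/
theorem exists_liftHom [Nonempty n] {G : Type*} [Group G] (ρ : G →* Matrix n n ℂ) (c : G →* ℂ)
    (hρ : ∀ g, ρ g ∈ Matrix.unitaryGroup n ℂ) (hc : ∀ g, c g ^ 2 * (ρ g).det = 1) :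
    ∃ f : G →* Spin n, ∀ g, IsLift (f g) (ρ g) (c g) := by
  choose f hf using fun g => exists_isLift (hρ g) (hc g)
  have hc0 : ∀ g, c g ≠ 0 := fun g h => by simpa [h] using hc g
  refine ⟨MonoidHom.mk' f fun a b => ?_, hf⟩
  -- The lifts are chosen independently; uniqueness makes the choice multiplicative.
  refine (hf (a * b)).unique (hc0 _) ?_
  rw [map_mul, map_mul]
  exact (hf a).mul (hf b)

end Generation

/-! ### Square roots in odd special unitary groups. -/

section SquareRoot

variable {n : Type} [Fintype n] [DecidableEq n]

-- The spectrum is finite, so any branch of the square root is continuous on it and functional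
-- calculus applies; the spectrum lies on the unit circle, so the result is unitary.
open scoped Matrix.Norms.L2Operator in
theorem exists_unitary_sq_eq {U : Matrix n n ℂ} (hU : U ∈ Matrix.unitaryGroup n ℂ) :
    ∃ V ∈ Matrix.unitaryGroup n ℂ, V ^ 2 = U := by
  have hn : IsStarNormal U := ⟨by
    rw [commute_iff_eq, Matrix.mem_unitaryGroup_iff.1 hU, Matrix.mem_unitaryGroup_iff'.1 hU]⟩
  have hfin := Matrix.finite_spectrum U
  have hcont : ∀ f : ℂ → ℂ, ContinuousOn f (spectrum ℂ U) := fun f => hfin.continuousOn f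
  choose s hs using fun z : ℂ => IsAlgClosed.exists_pow_nat_eq z two_pos
  refine ⟨cfc s U, ?_, ?_⟩
  · rw [Matrix.mem_unitaryGroup_iff, ← cfc_star, ← cfc_mul _ _ U (hcont _) (hcont _),
      ← cfc_one ℂ U]
    refine cfc_congr fun z hz => ?_
    have hz1 : ‖z‖ = 1 := by
      simpa using spectrum.subset_circle_of_unitary hU hz
    have h1 : ‖s z‖ = 1 := by
      rw [← hs z, norm_pow] at hz1
      exact (pow_eq_one_iff_of_nonneg (norm_nonneg _) two_ne_zero).1 hz1
    simp only [Pi.one_apply]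
    rw [Complex.star_def, Complex.mul_conj, Complex.normSq_eq_norm_sq, h1]
    simp
  · rw [← cfc_pow _ _ U (hcont _)]
    simp only [hs]
    exact cfc_id' ℂ U

/-- A unitary square root has determinant `±1`; in odd dimension, negating it corrects the
determinant and keeps the square. -/
theorem exists_sq_eq_of_odd (hn : Odd (Fintype.card n)) (A : SU n) : ∃ B : SU n, B ^ 2 = A := by
  obtain ⟨V, hV, hVA⟩ := exists_unitary_sq_eq A.2.1
  have hd : V.det ^ 2 = 1 := by rw [← Matrix.det_pow, hVA, SU.det_eq]
  rcases sq_eq_one_iff.1 hd with h | h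
  · exact ⟨⟨V, hV, h⟩, Subtype.ext hVA⟩
  · refine ⟨⟨-V, ?_⟩, Subtype.ext ?_⟩
    · rw [Matrix.mem_specialUnitaryGroup_iff]
      refine ⟨by simpa [Matrix.mem_unitaryGroup_iff] using hV, ?_⟩
      rw [Matrix.det_neg, hn.neg_one_pow, h]
      ring
    · change (-V) ^ 2 = _
      rw [neg_sq, hVA]

end SquareRoot

/-! ### Naturality of the Clifford action. -/

section Functoriality

variable {m n : Type} [Fintype m] [Fintype n]

theorem annihilation_map {f : CSpace m →ₗ[ℂ] CSpace n}
    (hf : ∀ v w, inner ℂ (f v) (f w) = inner ℂ v w) (v : CSpace m) (ω : Ext m) :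
    annihilation (f v) (ExteriorAlgebra.map f ω) = ExteriorAlgebra.map f (annihilation v ω) := by
  induction ω using CliffordAlgebra.left_induction with
  | algebraMap r =>
    have h : ∀ (k : Type) [Fintype k] (w : CSpace k), annihilation w (algebraMap ℂ (Ext k) r) = 0 :=
      fun k _ w => CliffordAlgebra.contractLeft_algebraMap (Q := 0) _ _
    have h1 : ExteriorAlgebra.map f (algebraMap ℂ (Ext m) r) = algebraMap ℂ (Ext n) r :=
      AlgHom.commutes _ _
    exact (congrArg _ h1).trans ((h n _).trans (by rw [h m v, map_zero]))
  | add x y hx hy => simp only [map_add, hx, hy]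
  | ι_mul x w hx =>
    have h : ∀ (k : Type) [Fintype k] (a b : CSpace k) (ω : Ext k),
        annihilation a (ExteriorAlgebra.ι ℂ b * ω) =
          inner ℂ a b • ω - ExteriorAlgebra.ι ℂ b * annihilation a ω :=
      fun k _ a b ω => CliffordAlgebra.contractLeft_ι_mul (Q := 0) _ _ _
    change annihilation (f v) (ExteriorAlgebra.map f (ExteriorAlgebra.ι ℂ w * x)) =
      ExteriorAlgebra.map f (annihilation v (ExteriorAlgebra.ι ℂ w * x))
    rw [map_mul, ExteriorAlgebra.map_apply_ι, h, h, hx, hf, map_sub, map_smul, map_mul,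
      ExteriorAlgebra.map_apply_ι]

/-- The Clifford action is natural with respect to isometric embeddings. -/
theorem cliffAct_map {f : CSpace m →ₗ[ℂ] CSpace n} {g : cliffForm m →qᵢ cliffForm n}
    (hf : ∀ v w, inner ℂ (f v) (f w) = inner ℂ v w) (hg : ∀ v, g v = f v) (x : Cliff m)
    (ω : Ext m) : cliffAct n (CliffordAlgebra.map g x) (ExteriorAlgebra.map f ω) =
      ExteriorAlgebra.map f (cliffAct m x ω) := by
  induction x using CliffordAlgebra.induction generalizing ω with
  | algebraMap r =>
    rw [AlgHom.commutes, AlgHom.commutes, AlgHom.commutes, Module.algebraMap_end_apply,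
      Module.algebraMap_end_apply, ← Complex.coe_smul, ← Complex.coe_smul, map_smul]
  | ι v =>
    rw [CliffordAlgebra.map_apply_ι, cliffAct_ι, cliffAct_ι, gammaOp_apply, gammaOp_apply, hg,
      annihilation_map hf, map_smul, map_add, map_mul, ExteriorAlgebra.map_apply_ι]
  | mul a b ha hb => simp only [map_mul, Module.End.mul_apply, ha, hb]
  | add a b ha hb => simp only [map_add, LinearMap.add_apply, ha, hb]

end Functoriality

/-! ### Vacuum scalars, rotations and kernel for η. -/

section Embeddings

/-- The complex linear inclusion `ℂ² → ℂ² ⊕ ℂ³`. -/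
def linEmbed4 : CSpace (Fin 2) →ₗ[ℂ] CSpace (Fin 2 ⊕ Fin 3) where
  toFun v := WithLp.toLp 2 (Sum.elim v.ofLp 0)
  map_add' v w := by
    ext i
    cases i <;> simp
  map_smul' r v := by
    ext i
    cases i <;> simp

/-- The complex linear inclusion `ℂ³ → ℂ² ⊕ ℂ³`. -/
def linEmbed6 : CSpace (Fin 3) →ₗ[ℂ] CSpace (Fin 2 ⊕ Fin 3) where
  toFun v := WithLp.toLp 2 (Sum.elim 0 v.ofLp)
  map_add' v w := by
    ext i
    cases i <;> simp
  map_smul' r v := by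
    ext i
    cases i <;> simp

theorem inner_linEmbed4 (v w : CSpace (Fin 2)) :
    inner ℂ (linEmbed4 v) (linEmbed4 w) = inner ℂ v w := by
  simp [linEmbed4, PiLp.inner_apply]

theorem inner_linEmbed6 (v w : CSpace (Fin 3)) :
    inner ℂ (linEmbed6 v) (linEmbed6 w) = inner ℂ v w := by
  simp [linEmbed6, PiLp.inner_apply]

theorem embed4_apply_ofLp (v : CSpace (Fin 2)) : (embed4 v).ofLp = Sum.elim v.ofLp (0 : Fin 3 → ℂ) := rfl

theorem embed6_apply_ofLp (v : CSpace (Fin 3)) : (embed6 v).ofLp = Sum.elim (0 : Fin 2 → ℂ) v.ofLp := rfl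

theorem embed4_injective : Function.Injective embed4 := by
  intro v w h
  ext i
  have := congrFun (congrArg WithLp.ofLp h) (Sum.inl i)
  simpa [embed4_apply_ofLp] using this

theorem embed6_injective : Function.Injective embed6 := by
  intro v w h
  ext i
  have := congrFun (congrArg WithLp.ofLp h) (Sum.inr i)
  simpa [embed6_apply_ofLp] using this

theorem exists_eq_embed_add (v : CSpace (Fin 2 ⊕ Fin 3)) : ∃ a b, v = embed4 a + embed6 b := by
  refine ⟨WithLp.toLp 2 fun i => v (Sum.inl i), WithLp.toLp 2 fun i => v (Sum.inr i), ?_⟩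
  ext i
  cases i <;> simp [embed4_apply_ofLp, embed6_apply_ofLp]

theorem act_fromBlocks_embed4 (A : Matrix (Fin 2) (Fin 2) ℂ) (B : Matrix (Fin 3) (Fin 3) ℂ)
    (v : CSpace (Fin 2)) : act (Matrix.fromBlocks A 0 0 B) (embed4 v) = embed4 (act A v) := by
  apply WithLp.ofLp_injective
  rw [act_apply_ofLp, embed4_apply_ofLp, embed4_apply_ofLp, Matrix.fromBlocks_mulVec]
  simp

theorem act_fromBlocks_embed6 (A : Matrix (Fin 2) (Fin 2) ℂ) (B : Matrix (Fin 3) (Fin 3) ℂ)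
    (v : CSpace (Fin 3)) : act (Matrix.fromBlocks A 0 0 B) (embed6 v) = embed6 (act B v) := by
  apply WithLp.ofLp_injective
  rw [act_apply_ofLp, embed6_apply_ofLp, embed6_apply_ofLp, Matrix.fromBlocks_mulVec]
  simp

theorem eta_coe (x : Spin4) (y : Spin6) : (eta (x, y) : Cliff (Fin 2 ⊕ Fin 3)) =
    CliffordAlgebra.map embed4 (x : Cliff (Fin 2)) * CliffordAlgebra.map embed6 y := rfl

theorem eta_coe' (x : Spin4) (y : Spin6) : (eta (x, y) : Cliff (Fin 2 ⊕ Fin 3)) =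
    CliffordAlgebra.map embed6 (y : Cliff (Fin 3)) * CliffordAlgebra.map embed4 x := by
  rw [eta_coe]
  exact congrArg Subtype.val (spinMap_commute x y).eq

theorem map_embed6_mul_ι_embed4 (y : Spin6) (v : CSpace (Fin 2)) :
    CliffordAlgebra.map embed6 (y : Cliff (Fin 3)) *
        CliffordAlgebra.ι (cliffForm (Fin 2 ⊕ Fin 3)) (embed4 v) =
      CliffordAlgebra.ι (cliffForm (Fin 2 ⊕ Fin 3)) (embed4 v) *
        CliffordAlgebra.map embed6 (y : Cliff (Fin 3)) := by
  rw [← CliffordAlgebra.map_apply_ι]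
  exact (CliffordAlgebra.commute_map_mul_map_of_isOrtho_of_mem_evenOdd_zero_right embed4 embed6
    embed_isOrtho _ _ (CliffordAlgebra.ι_mem_evenOdd_one _ v) y.2.2).eq.symm

theorem map_embed4_mul_ι_embed6 (x : Spin4) (v : CSpace (Fin 3)) :
    CliffordAlgebra.map embed4 (x : Cliff (Fin 2)) *
        CliffordAlgebra.ι (cliffForm (Fin 2 ⊕ Fin 3)) (embed6 v) =
      CliffordAlgebra.ι (cliffForm (Fin 2 ⊕ Fin 3)) (embed6 v) *
        CliffordAlgebra.map embed4 (x : Cliff (Fin 2)) := by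
  rw [← CliffordAlgebra.map_apply_ι]
  exact (CliffordAlgebra.commute_map_mul_map_of_isOrtho_of_mem_evenOdd_zero_left embed4 embed6
    embed_isOrtho _ _ x.2.2 (CliffordAlgebra.ι_mem_evenOdd_one _ v)).eq

theorem eta_mul_ι_embed4 (x : Spin4) (y : Spin6) {v w : CSpace (Fin 2)}
    (h : (x : Cliff (Fin 2)) * CliffordAlgebra.ι (cliffForm (Fin 2)) v =
      CliffordAlgebra.ι (cliffForm (Fin 2)) w * (x : Cliff (Fin 2))) :
    (eta (x, y) : Cliff (Fin 2 ⊕ Fin 3)) *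
        CliffordAlgebra.ι (cliffForm (Fin 2 ⊕ Fin 3)) (embed4 v) =
      CliffordAlgebra.ι (cliffForm (Fin 2 ⊕ Fin 3)) (embed4 w) *
        (eta (x, y) : Cliff (Fin 2 ⊕ Fin 3)) := by
  have h' := congrArg (CliffordAlgebra.map embed4) h
  rw [map_mul, map_mul, CliffordAlgebra.map_apply_ι, CliffordAlgebra.map_apply_ι] at h'
  rw [eta_coe, mul_assoc, map_embed6_mul_ι_embed4, ← mul_assoc, h', mul_assoc]

theorem eta_mul_ι_embed6 (x : Spin4) (y : Spin6) {v w : CSpace (Fin 3)}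
    (h : (y : Cliff (Fin 3)) * CliffordAlgebra.ι (cliffForm (Fin 3)) v =
      CliffordAlgebra.ι (cliffForm (Fin 3)) w * (y : Cliff (Fin 3))) :
    (eta (x, y) : Cliff (Fin 2 ⊕ Fin 3)) *
        CliffordAlgebra.ι (cliffForm (Fin 2 ⊕ Fin 3)) (embed6 v) =
      CliffordAlgebra.ι (cliffForm (Fin 2 ⊕ Fin 3)) (embed6 w) *
        (eta (x, y) : Cliff (Fin 2 ⊕ Fin 3)) := by
  have h' := congrArg (CliffordAlgebra.map embed6) h
  rw [map_mul, map_mul, CliffordAlgebra.map_apply_ι, CliffordAlgebra.map_apply_ι] at h'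
  rw [eta_coe', mul_assoc, map_embed4_mul_ι_embed6, ← mul_assoc, h', mul_assoc]

/-- The vacuum is the image of 1 under both inclusions of exterior algebras, so by naturality each
factor contributes its own scalar. -/
theorem isLift_eta {x : Spin4} {y : Spin6} {A : Matrix (Fin 2) (Fin 2) ℂ}
    {B : Matrix (Fin 3) (Fin 3) ℂ} {c d : ℂ} (hx : IsLift x A c) (hy : IsLift y B d) :
    IsLift (eta (x, y)) (Matrix.fromBlocks A 0 0 B) (c * d) := by
  refine ⟨coversRotation_iff.2 fun v => ?_, ?_⟩
  · obtain ⟨a, b, rfl⟩ := exists_eq_embed_add v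
    rw [map_add (act _), act_fromBlocks_embed4, act_fromBlocks_embed6, map_add, map_add, mul_add,
      add_mul, eta_mul_ι_embed4 x y (coversRotation_iff.1 hx.covers a),
      eta_mul_ι_embed6 x y (coversRotation_iff.1 hy.covers b)]
  · have h4 := cliffAct_map (g := embed4) inner_linEmbed4 (fun _ => rfl) x 1
    have h6 := cliffAct_map (g := embed6) inner_linEmbed6 (fun _ => rfl) y 1
    have hx' : cliffAct (Fin 2) x 1 = c • 1 := hx.vacuum
    have hy' : cliffAct (Fin 3) y 1 = d • 1 := hy.vacuum
    rw [hx', map_smul,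
      map_one (ExteriorAlgebra.map linEmbed4)] at h4
    rw [hy', map_smul,
      map_one (ExteriorAlgebra.map linEmbed6)] at h6
    rw [dirac_apply, eta_coe, map_mul, Module.End.mul_apply, h6, map_smul, h4, smul_smul, mul_comm]

/-- `x` and `y` conjugate vectors of their own summand to vectors of that summand, and being even
they commute with vectors of the other; so the rotation has no off-diagonal blocks. -/
theorem exists_fromBlocks_of_covers_eta {x : Spin4} {y : Spin6}
    {M : Matrix (Fin 2 ⊕ Fin 3) (Fin 2 ⊕ Fin 3) ℂ} (h : CoversRotation (eta (x, y)) M) :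
    ∃ A B, M = Matrix.fromBlocks A 0 0 B := by
  have h4 : ∀ v : CSpace (Fin 2), ∃ w, act M (embed4 v) = embed4 w := by
    intro v
    obtain ⟨w, hw⟩ := spin_exists_conj x v
    refine ⟨w, cliff_ι_injective ?_⟩
    rw [← h, spin_conj_eq_iff]
    exact eta_mul_ι_embed4 x y ((spin_conj_eq_iff _ _ _).1 hw)
  have h6 : ∀ v : CSpace (Fin 3), ∃ w, act M (embed6 v) = embed6 w := by
    intro v
    obtain ⟨w, hw⟩ := spin_exists_conj y v
    refine ⟨w, cliff_ι_injective ?_⟩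
    rw [← h, spin_conj_eq_iff]
    exact eta_mul_ι_embed6 x y ((spin_conj_eq_iff _ _ _).1 hw)
  refine ⟨M.toBlocks₁₁, M.toBlocks₂₂, ?_⟩
  conv_lhs => rw [← Matrix.fromBlocks_toBlocks M]
  congr 1
  · ext i j
    obtain ⟨w, hw⟩ := h6 (EuclideanSpace.single j 1)
    have := congrFun (congrArg WithLp.ofLp hw) (Sum.inl i)
    rw [act_apply_ofLp, embed6_apply_ofLp, embed6_apply_ofLp] at this
    simpa [Matrix.mulVec, dotProduct, Pi.single_apply, Matrix.toBlocks₁₂] using this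
  · ext i j
    obtain ⟨w, hw⟩ := h4 (EuclideanSpace.single j 1)
    have := congrFun (congrArg WithLp.ofLp hw) (Sum.inr i)
    rw [act_apply_ofLp, embed4_apply_ofLp, embed4_apply_ofLp] at this
    simpa [Matrix.mulVec, dotProduct, Pi.single_apply, Matrix.toBlocks₂₁] using this

/-- If the product is 1, then `x` and `y` each commute with their vectors, so each is `±1`; mixed
signs would give `1 = -1` in the Clifford algebra. -/
theorem ker_eta_le_Z2 : eta.ker ≤ Z2 := by
  rintro ⟨x, y⟩ h
  rw [MonoidHom.mem_ker] at h
  have hx : (x : Cliff (Fin 2)) = 1 ∨ (x : Cliff (Fin 2)) = -1 := by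
    refine spin_eq_one_or_neg_one_of_commute x fun v => ?_
    obtain ⟨w, hw⟩ := spin_exists_conj x v
    rw [spin_conj_eq_iff] at hw
    have h1 := eta_mul_ι_embed4 x y hw
    rw [h, Submonoid.coe_one, one_mul, mul_one] at h1
    rw [hw, embed4_injective (cliff_ι_injective h1)]
  have hy : (y : Cliff (Fin 3)) = 1 ∨ (y : Cliff (Fin 3)) = -1 := by
    refine spin_eq_one_or_neg_one_of_commute y fun v => ?_
    obtain ⟨w, hw⟩ := spin_exists_conj y v
    rw [spin_conj_eq_iff] at hw
    have h1 := eta_mul_ι_embed6 x y hw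
    rw [h, Submonoid.coe_one, one_mul, mul_one] at h1
    rw [hw, embed6_injective (cliff_ι_injective h1)]
  have hxy : (1 : Cliff (Fin 2 ⊕ Fin 3)) =
      CliffordAlgebra.map embed4 (x : Cliff (Fin 2)) * CliffordAlgebra.map embed6 y := by
    rw [← eta_coe, h, Submonoid.coe_one]
  have hne : (1 : Cliff (Fin 2 ⊕ Fin 3)) ≠ -1 := by
    intro h1
    have h2 : algebraMap ℝ (Cliff (Fin 2 ⊕ Fin 3)) 1 = algebraMap ℝ _ (-1) := by
      rw [map_neg, map_one, ← h1]
    have := FaithfulSMul.algebraMap_injective ℝ (Cliff (Fin 2 ⊕ Fin 3)) h2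
    norm_num at this
  rcases hx with hx | hx <;> rcases hy with hy | hy <;> rw [hx, hy] at hxy
  · exact Or.inl (Prod.ext (Subtype.ext hx) (Subtype.ext hy))
  · exact absurd hxy (by simpa using hne)
  · exact absurd hxy (by simpa using hne)
  · exact Or.inr (Prod.ext (Subtype.ext hx) (Subtype.ext hy))

theorem etaBar_injective : Function.Injective etaBar := by
  rw [injective_iff_map_eq_one]
  intro q hq
  induction q using QuotientGroup.induction_on with
  | H a => exact (QuotientGroup.eq_one_iff a).2 (ker_eta_le_Z2 hq)

end Embeddings

/-! ### Standard basis vectors in the exterior algebra. -/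

section DegreeOne

variable {n : Type} [Fintype n]

theorem basisVec_sq [DecidableEq n] (i : n) : basisVec i * basisVec i = (0 : Ext n) :=
  ExteriorAlgebra.ι_sq_zero _

theorem basisVec_swap [DecidableEq n] (i j : n) :
    (basisVec i * basisVec j : Ext n) = -(basisVec j * basisVec i) :=
  eq_neg_of_add_eq_zero_left (ExteriorAlgebra.ι_add_mul_swap _ _)

theorem degOne_eq_sum [DecidableEq n] (p : n → ℂ) : degOne p = ∑ i, p i • basisVec i := by
  have h : (WithLp.toLp 2 p : CSpace n) = ∑ i, p i • WithLp.toLp 2 (Pi.single i 1) := by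
    ext j
    simp [Finset.sum_apply, Pi.single_apply]
  simp only [degOne, basisVec]
  rw [h, map_sum]
  simp only [map_smul]

variable [DecidableEq n] {x : Spin n} {U : Matrix n n ℂ} {c : ℂ}

theorem CoversRotation.dirac_degOne_mul (hx : CoversRotation x U) (p : n → ℂ) (ω : Ext n) :
    dirac n x (degOne p * ω) = degOne (U *ᵥ p) * dirac n x ω :=
  hx.dirac_ι_mul _ ω

theorem CoversRotation.dirac_basisVec_mul (hx : CoversRotation x U) (i : n) (ω : Ext n) :
    dirac n x (basisVec i * ω) = (∑ j, U j i • basisVec j) * dirac n x ω := by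
  rw [basisVec, hx.dirac_degOne_mul, degOne_eq_sum]
  simp

theorem IsLift.dirac_degOne (hx : IsLift x U c) (p : n → ℂ) :
    dirac n x (degOne p) = c • degOne (U *ᵥ p) := by
  rw [← mul_one (degOne p), hx.covers.dirac_degOne_mul, hx.vacuum, mul_smul_comm, mul_one]

theorem IsLift.dirac_basisVec (hx : IsLift x U c) (i : n) :
    dirac n x (basisVec i) = c • ∑ j, U j i • basisVec j := by
  rw [← mul_one (basisVec i), hx.covers.dirac_basisVec_mul, hx.vacuum, mul_smul_comm, mul_one]

theorem degOne_smul (z : ℂ) (p : n → ℂ) : degOne (z • p) = z • degOne p := by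
  simp [degOne_eq_sum, Finset.smul_sum, smul_smul]

end DegreeOne

/-! ### The Dirac representation of Spin(4) in coordinates. -/

section Isospin

variable {x : Spin4} {U : Matrix (Fin 2) (Fin 2) ℂ} {c : ℂ}

/-- In degrees 0, 1, 2 the element acts as `c`, `c • U` and `c * U.det`. -/
theorem IsLift.dirac_isospinMap (hx : IsLift x U c) (p q : Fin 2 → ℂ) :
    dirac (Fin 2) x (isospinMap p q) =
      isospinMap ((c • U) *ᵥ p) ![c * U.det * q 0, c * q 1] := by
  have h01 : dirac (Fin 2) x (basisVec 0 * basisVec 1) =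
      (c * U.det) • (basisVec 0 * basisVec 1) := by
    rw [hx.covers.dirac_basisVec_mul, hx.dirac_basisVec, Matrix.det_fin_two]
    simp only [Fin.sum_univ_two, add_mul, mul_add, smul_mul_assoc, mul_smul_comm, smul_add,
      basisVec_sq, basisVec_swap (1 : Fin 2) 0]
    module
  simp only [isospinMap, map_add, map_smul, hx.dirac_degOne, h01, hx.vacuum, Matrix.smul_mulVec,
    degOne_smul, smul_smul, Matrix.cons_val_zero, Matrix.cons_val_one]
  module

/-- Surjectivity is what lets `AlphaRel` determine the whole Dirac operator. -/
theorem exists_eq_isospinMap (ω : Ext (Fin 2)) : ∃ p q, ω = isospinMap p q := by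
  induction ω using CliffordAlgebra.left_induction with
  | algebraMap r =>
    refine ⟨0, ![0, r], ?_⟩
    simp only [isospinMap, degOne_eq_sum, Algebra.algebraMap_eq_smul_one]
    simp
  | add a b ha hb =>
    obtain ⟨p, q, rfl⟩ := ha
    obtain ⟨p', q', rfl⟩ := hb
    refine ⟨p + p', q + q', ?_⟩
    simp only [isospinMap, degOne_eq_sum, Fin.sum_univ_two, Pi.add_apply]
    module
  | ι_mul a v ha =>
    obtain ⟨p, q, rfl⟩ := ha
    refine ⟨q 1 • v.ofLp, ![v 0 * p 1 - v 1 * p 0, 0], ?_⟩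
    change degOne v.ofLp * _ = _
    have h0 : (basisVec 0 * (basisVec 0 * basisVec 1) : Ext (Fin 2)) = 0 := by
      rw [← mul_assoc, basisVec_sq, zero_mul]
    have h1 : (basisVec 1 * (basisVec 0 * basisVec 1) : Ext (Fin 2)) = 0 := by
      rw [← mul_assoc, basisVec_swap, neg_mul, mul_assoc, basisVec_sq, mul_zero, neg_zero]
    simp only [isospinMap, degOne_eq_sum, Fin.sum_univ_two, add_mul, mul_add, smul_mul_assoc,
      mul_smul_comm, smul_add, basisVec_sq, basisVec_swap (1 : Fin 2) 0, h0, h1, mul_one,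
      Pi.smul_apply, smul_eq_mul, Matrix.cons_val_zero, Matrix.cons_val_one]
    module

end Isospin

/-! ### The Dirac representation of Spin(6) in coordinates. -/

section Color

variable {x : Spin6} {U : Matrix (Fin 3) (Fin 3) ℂ} {c : ℂ}

theorem adjugate_eq_of_unitary (hU : U ∈ Matrix.unitaryGroup (Fin 3) ℂ) :
    U.adjugate = U.det • star U := by
  rw [← one_mul U.adjugate, ← Matrix.mem_unitaryGroup_iff'.1 hU, mul_assoc, Matrix.mul_adjugate,
    Matrix.mul_smul, mul_one]

theorem basisVec_mul_three :
    (basisVec 0 * (basisVec 0 * basisVec 1) : Ext (Fin 3)) = 0 ∧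
    (basisVec 1 * (basisVec 0 * basisVec 1) : Ext (Fin 3)) = 0 ∧
    (basisVec 2 * (basisVec 0 * basisVec 1) : Ext (Fin 3)) =
      basisVec 0 * (basisVec 1 * basisVec 2) ∧
    (basisVec 0 * (basisVec 2 * basisVec 0) : Ext (Fin 3)) = 0 ∧
    (basisVec 1 * (basisVec 2 * basisVec 0) : Ext (Fin 3)) =
      basisVec 0 * (basisVec 1 * basisVec 2) ∧
    (basisVec 2 * (basisVec 2 * basisVec 0) : Ext (Fin 3)) = 0 ∧
    (basisVec 1 * (basisVec 1 * basisVec 2) : Ext (Fin 3)) = 0 ∧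
    (basisVec 2 * (basisVec 1 * basisVec 2) : Ext (Fin 3)) = 0 := by
  have h : ∀ i j : Fin 3, (basisVec i * (basisVec i * basisVec j) : Ext (Fin 3)) = 0 := by
    intro i j
    rw [← mul_assoc, basisVec_sq, zero_mul]
  have h' : ∀ i j : Fin 3, (basisVec i * (basisVec j * basisVec i) : Ext (Fin 3)) = 0 := by
    intro i j
    rw [← mul_assoc, basisVec_swap, neg_mul, mul_assoc, basisVec_sq, mul_zero, neg_zero]
  have h3 : ∀ i j k : Fin 3, (basisVec i * (basisVec j * basisVec k) : Ext (Fin 3)) =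
      basisVec j * (basisVec k * basisVec i) := by
    intro i j k
    rw [← mul_assoc, basisVec_swap i j, neg_mul, mul_assoc, basisVec_swap i k, mul_neg, neg_neg]
  exact ⟨h _ _, h' _ _, h3 _ _ _, h' _ _, by rw [h3, h3], h _ _, h _ _, h' _ _⟩

theorem basisVec_mul_four (i : Fin 3) :
    (basisVec i * (basisVec 0 * (basisVec 1 * basisVec 2)) : Ext (Fin 3)) = 0 := by
  obtain ⟨-, -, -, -, -, -, h1, h2⟩ := basisVec_mul_three
  fin_cases i
  · change (basisVec 0 * (basisVec 0 * (basisVec 1 * basisVec 2)) : Ext (Fin 3)) = 0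
    rw [← mul_assoc, basisVec_sq, zero_mul]
  · change (basisVec 1 * (basisVec 0 * (basisVec 1 * basisVec 2)) : Ext (Fin 3)) = 0
    rw [← mul_assoc, basisVec_swap, neg_mul, mul_assoc, h1, mul_zero, neg_zero]
  · change (basisVec 2 * (basisVec 0 * (basisVec 1 * basisVec 2)) : Ext (Fin 3)) = 0
    rw [← mul_assoc, basisVec_swap, neg_mul, mul_assoc, h2, mul_zero, neg_zero]

theorem exists_eq_colorMap (ω : Ext (Fin 3)) : ∃ p q, ω = colorMap p q := by
  induction ω using CliffordAlgebra.left_induction with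
  | algebraMap r =>
    refine ⟨0, Sum.elim 0 ![r], ?_⟩
    simp only [colorMap, degOne_eq_sum, Algebra.algebraMap_eq_smul_one]
    simp
  | add a b ha hb =>
    obtain ⟨p, q, rfl⟩ := ha
    obtain ⟨p', q', rfl⟩ := hb
    refine ⟨p + p', q + q', ?_⟩
    simp only [colorMap, degOne_eq_sum, Fin.sum_univ_three, Pi.add_apply]
    module
  | ι_mul a v ha =>
    obtain ⟨p, q, rfl⟩ := ha
    -- Wedging with `v` is the cross product from degree one to two and the dot product from degree
    -- two to three.
    refine ⟨Sum.elim (q (Sum.inr 0) • v.ofLp) ![v 0 * q (Sum.inl 0) + v 1 * q (Sum.inl 1) +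
        v 2 * q (Sum.inl 2)],
      Sum.elim ![v 1 * p (Sum.inl 2) - v 2 * p (Sum.inl 1), v 2 * p (Sum.inl 0) -
        v 0 * p (Sum.inl 2), v 0 * p (Sum.inl 1) - v 1 * p (Sum.inl 0)] 0, ?_⟩
    change degOne v.ofLp * _ = _
    obtain ⟨h1, h2, h3, h4, h5, h6, h7, h8⟩ := basisVec_mul_three
    simp only [colorMap, degOne_eq_sum, Fin.sum_univ_three, add_mul, mul_add, smul_mul_assoc,
      mul_smul_comm, smul_add, mul_assoc, basisVec_sq, basisVec_swap (1 : Fin 3) 0,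
      basisVec_swap (2 : Fin 3) 1, basisVec_swap (0 : Fin 3) 2, h1, h2, h3, h4, h5, h6, h7, h8,
      basisVec_mul_four, mul_one, Sum.elim_inl, Sum.elim_inr, Pi.zero_apply,
      Pi.smul_apply, smul_eq_mul, Matrix.cons_val_zero, Matrix.cons_val_one, Matrix.cons_val]
    module

/-- In the basis `g ∧ b, b ∧ r, r ∧ g` of degree two, the induced map has the 2 × 2 minors of `U` as
entries, which is the transposed adjugate. -/
theorem IsLift.dirac_colorMap (hx : IsLift x U c) (p q : Fin 3 ⊕ Fin 1 → ℂ) :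
    dirac (Fin 3) x (colorMap p q) =
      colorMap (Matrix.fromBlocks (c • U) 0 0 ((c * U.det) • (1 : Matrix (Fin 1) (Fin 1) ℂ)) *ᵥ p)
        (Matrix.fromBlocks (c • U.adjugateᵀ) 0 0 (c • (1 : Matrix (Fin 1) (Fin 1) ℂ)) *ᵥ q) := by
  obtain ⟨h1, h2, h3, h4, h5, h6, h7, h8⟩ := basisVec_mul_three
  have hij : ∀ i j : Fin 3, dirac (Fin 3) x (basisVec i * basisVec j) =
      (c * (U 1 i * U 2 j - U 2 i * U 1 j)) • (basisVec 1 * basisVec 2) +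
      (c * (U 2 i * U 0 j - U 0 i * U 2 j)) • (basisVec 2 * basisVec 0) +
      (c * (U 0 i * U 1 j - U 1 i * U 0 j)) • (basisVec 0 * basisVec 1) := by
    intro i j
    rw [hx.covers.dirac_basisVec_mul, hx.dirac_basisVec]
    simp only [Fin.sum_univ_three, add_mul, mul_add, smul_mul_assoc, mul_smul_comm, smul_add,
      basisVec_sq, basisVec_swap (1 : Fin 3) 0, basisVec_swap (2 : Fin 3) 1,
      basisVec_swap (0 : Fin 3) 2]
    module
  have hvol : dirac (Fin 3) x (basisVec 0 * (basisVec 1 * basisVec 2)) =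
      (c * U.det) • (basisVec 0 * (basisVec 1 * basisVec 2)) := by
    rw [hx.covers.dirac_basisVec_mul, hij, Matrix.det_fin_three]
    simp only [Fin.sum_univ_three, add_mul, mul_add, smul_mul_assoc, mul_smul_comm, smul_add,
      h1, h2, h3, h4, h5, h6, h7, h8]
    module
  rw [Matrix.fromBlocks_mulVec, Matrix.fromBlocks_mulVec]
  simp only [colorMap, map_add, map_smul, hx.dirac_degOne, hij, hvol, hx.vacuum, mul_assoc]
  simp only [degOne_eq_sum, Fin.sum_univ_three, Sum.elim_inl, Sum.elim_inr, Matrix.zero_mulVec, add_zero,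
    zero_add, Matrix.smul_mulVec, Matrix.one_mulVec, Pi.smul_apply, Matrix.mulVec, dotProduct,
    Matrix.transpose_apply, Matrix.adjugate_fin_three, smul_eq_mul, Matrix.of_apply,
    Matrix.cons_val_zero, Matrix.cons_val_one, Matrix.cons_val, Function.comp_apply]
  module

end Color

/-! ### Faithfulness of the Dirac representation. -/

theorem dirac_injective {n : Type} [Fintype n] {x y : Spin n} (h : dirac n x = dirac n y) :
    x = y := by
  have hz : dirac n (y⁻¹ * x) = 1 := by
    rw [map_mul, h, ← map_mul, inv_mul_cancel, map_one]
  -- Clifford multiplication determines the vector, so an element acting trivially must commute with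
  -- every vector and is `±1`.
  have hg : ∀ v : CSpace n, gammaOp n v = 0 → v = 0 := by
    intro v hv
    have h1 := gammaOp_sq v
    rw [hv, zero_mul, eq_comm, FaithfulSMul.algebraMap_eq_zero_iff, cliffForm_apply] at h1
    simpa using h1
  have hc : ∀ v, ((y⁻¹ * x : Spin n) : Cliff n) * CliffordAlgebra.ι (cliffForm n) v =
      CliffordAlgebra.ι (cliffForm n) v * ((y⁻¹ * x : Spin n) : Cliff n) := by
    intro v
    obtain ⟨w, hw⟩ := spin_exists_conj (y⁻¹ * x) v
    rw [spin_conj_eq_iff] at hw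
    have h1 := congrArg (cliffAct n) hw
    rw [map_mul, map_mul, cliffAct_ι, cliffAct_ι, ← dirac_apply, hz, one_mul, mul_one,
      ← sub_eq_zero, ← map_sub] at h1
    rw [hw, sub_eq_zero.1 (hg _ h1)]
  rcases spin_eq_one_or_neg_one_of_commute _ hc with h1 | h1
  · exact (inv_mul_eq_one.1 (Subtype.ext h1)).symm
  · exfalso
    rw [dirac_apply, h1, map_neg, map_one] at hz
    have h2 := LinearMap.congr_fun hz 1
    rw [LinearMap.neg_apply, Module.End.one_apply, ← neg_one_smul ℂ] at h2
    have h3 := smul_left_injective ℂ (one_ne_zero (α := Ext n)) (h2.trans (one_smul ℂ 1).symm)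
    norm_num at h3

theorem AlphaRel.unique {a : SU (Fin 2) × SU (Fin 2) × SU4} {x y : Spin4 × Spin6}
    (hx : AlphaRel a x) (hy : AlphaRel a y) : x = y := by
  refine Prod.ext (dirac_injective (LinearMap.ext fun ω => ?_))
    (dirac_injective (LinearMap.ext fun ω => ?_))
  · obtain ⟨p, q, rfl⟩ := exists_eq_isospinMap ω
    rw [hx.1, hy.1]
  · obtain ⟨p, q, rfl⟩ := exists_eq_colorMap ω
    rw [hx.2, hy.2]

/-! ### The homomorphisms θ and ψ, and the image and kernel of φ. -/

theorem smul_mem_unitaryGroup {n : Type} [Fintype n] [DecidableEq n] (z : Circle) (A : SU n) :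
    (z : ℂ) • (A : Matrix n n ℂ) ∈ Matrix.unitaryGroup n ℂ := by
  rw [Matrix.mem_unitaryGroup_iff, Matrix.star_eq_conjTranspose, Matrix.conjTranspose_smul,
    Matrix.smul_mul, Matrix.mul_smul, smul_smul, circle_mul_star, one_smul, SU.isUnitary]

/-- The unitary action `(α, g, h) ↦ α³ g` on `ℂ²`. -/
def weakRep : GSM →* Matrix (Fin 2) (Fin 2) ℂ where
  toFun s := ((s.1 ^ 3 : Circle) : ℂ) • (s.2.1 : Matrix (Fin 2) (Fin 2) ℂ)
  map_one' := by simp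
  map_mul' s t := by simp [mul_pow, smul_smul, mul_comm]

/-- The unitary action `(α, g, h) ↦ α⁻² h` on `ℂ³`. -/
def colorRep : GSM →* Matrix (Fin 3) (Fin 3) ℂ where
  toFun s := ((s.1 ^ (-2 : ℤ) : Circle) : ℂ) • (s.2.2 : Matrix (Fin 3) (Fin 3) ℂ)
  map_one' := by simp
  map_mul' s t := by simp [mul_pow, smul_smul, mul_comm]

/-- The character `(α, g, h) ↦ αᵏ`. -/
def hyperchar (k : ℤ) : GSM →* ℂ where
  toFun s := ((s.1 ^ k : Circle) : ℂ)
  map_one' := by simp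
  map_mul' s t := by simp [mul_zpow]

theorem phi_coe (s : GSM) : (phi s : Matrix (Fin 2 ⊕ Fin 3) (Fin 2 ⊕ Fin 3) ℂ) =
    Matrix.fromBlocks (weakRep s) 0 0 (colorRep s) := rfl

theorem det_weakRep (s : GSM) : (weakRep s).det = (s.1 : ℂ) ^ 6 := by
  change (((s.1 ^ 3 : Circle) : ℂ) • (s.2.1 : Matrix (Fin 2) (Fin 2) ℂ)).det = _
  rw [Matrix.det_smul, SU.det_eq, mul_one, Circle.coe_pow, ← pow_mul]
  rfl

theorem det_colorRep (s : GSM) : (colorRep s).det = (s.1 : ℂ) ^ (-6 : ℤ) := by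
  change (((s.1 ^ (-2 : ℤ) : Circle) : ℂ) • (s.2.2 : Matrix (Fin 3) (Fin 3) ℂ)).det = _
  rw [Matrix.det_smul, SU.det_eq, mul_one, Circle.coe_zpow, ← zpow_natCast, ← zpow_mul]
  rfl

/-- For isospin the degrees 0, 1, 2 give `α⁻³`, `g`, `α³`. For color, degrees 1 and 3 give `α h` and
`α⁻³`, while degrees 2 and 0 give their duals: the adjugate of a unitary matrix is its determinant
times its conjugate transpose. -/
theorem alphaRel_of_isLift {s : GSM} {x : Spin4} {y : Spin6}
    (hx : IsLift x (weakRep s) (hyperchar (-3) s)) (hy : IsLift y (colorRep s) (hyperchar 3 s)) :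
    AlphaRel (beta s) (x, y) := by
  have hs := s.1.coe_ne_zero
  have hss := circle_mul_star s.1
  have e3 : hyperchar 3 s = (s.1 : ℂ) ^ 3 := rfl
  have em3 : hyperchar (-3) s = ((s.1 : ℂ) ^ 3)⁻¹ := by
    change ((s.1 ^ (-3 : ℤ) : Circle) : ℂ) = _
    simp
  constructor
  · intro p q
    rw [hx.dirac_isospinMap]
    congr 1
    · congr 1
      change hyperchar (-3) s • (((s.1 ^ 3 : Circle) : ℂ) • (s.2.1 : Matrix (Fin 2) (Fin 2) ℂ)) = _
      rw [smul_smul, em3, Circle.coe_pow, inv_mul_cancel₀ (pow_ne_zero _ hs), one_smul]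
      rfl
    · change _ = Matrix.diagonal ![((s.1 ^ 3 : Circle) : ℂ), (((s.1 ^ 3)⁻¹ : Circle) : ℂ)] *ᵥ q
      rw [det_weakRep, em3]
      funext i
      rw [Matrix.mulVec_diagonal]
      fin_cases i
      · simp
        left
        field_simp
      · simp
  · intro p q
    have hU : colorRep s ∈ Matrix.unitaryGroup (Fin 3) ℂ := smul_mem_unitaryGroup _ _
    have hcoe : colorRep s = ((s.1 : ℂ) ^ 2)⁻¹ • (s.2.2 : Matrix (Fin 3) (Fin 3) ℂ) := by
      change ((s.1 ^ (-2 : ℤ) : Circle) : ℂ) • (s.2.2 : Matrix (Fin 3) (Fin 3) ℂ) = _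
      congr 1
    have hinv : (((beta s).2.2⁻¹ : SU4) : Matrix (Fin 3 ⊕ Fin 1) (Fin 3 ⊕ Fin 1) ℂ) =
        (Matrix.fromBlocks ((s.1 : ℂ) • (s.2.2 : Matrix (Fin 3) (Fin 3) ℂ)) 0 0
          (((s.1 ^ (-3 : ℤ) : Circle) : ℂ) • 1))ᴴ := rfl
    rw [hy.dirac_colorMap, adjugate_eq_of_unitary hU, det_colorRep]
    congr 1
    · change _ = Matrix.fromBlocks ((s.1 : ℂ) • (s.2.2 : Matrix (Fin 3) (Fin 3) ℂ)) 0 0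
          (((s.1 ^ (-3 : ℤ) : Circle) : ℂ) • 1) *ᵥ p
      congr 2
      · rw [hcoe, smul_smul, e3]
        congr 1
        field_simp
      · rw [e3, Circle.coe_zpow, ← zpow_natCast, ← zpow_add₀ hs]
        rfl
    · rw [hinv, Matrix.fromBlocks_conjTranspose, Matrix.fromBlocks_transpose]
      have hsi : star (s.1 : ℂ) = (s.1 : ℂ)⁻¹ := eq_inv_of_mul_eq_one_right hss
      congr 2
      · rw [hcoe, e3, star_smul, Matrix.transpose_smul, Matrix.conjTranspose_smul,
          Matrix.transpose_smul, smul_smul, Matrix.transpose_smul, smul_smul,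
          Matrix.star_eq_conjTranspose, hsi, star_inv₀, star_pow, hsi]
        congr 1
        rw [zpow_neg]
        field_simp
      · simp
      · simp
      · rw [Matrix.conjTranspose_smul, Circle.coe_zpow, star_zpow₀, hsi, e3]
        simp

/-- The lift of `(α, g, h) ↦ (α³ g, α⁻² h)` to `Spin(4) × Spin(6)`. -/
theorem exists_theta : ∃ θ : GSM →* Spin4 × Spin6,
    ∀ s, IsLift (θ s).1 (weakRep s) (hyperchar (-3) s) ∧
      IsLift (θ s).2 (colorRep s) (hyperchar 3 s) := by
  obtain ⟨f, hf⟩ := exists_liftHom weakRep (hyperchar (-3)) (fun s => smul_mem_unitaryGroup _ _)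
    (fun s => by
      have hs := s.1.coe_ne_zero
      rw [det_weakRep]
      simp [hyperchar]
      field_simp)
  obtain ⟨g, hg⟩ := exists_liftHom colorRep (hyperchar 3) (fun s => smul_mem_unitaryGroup _ _)
    (fun s => by
      have hs := s.1.coe_ne_zero
      rw [det_colorRep]
      simp [hyperchar]
      field_simp)
  exact ⟨f.prod g, fun s => ⟨hf s, hg s⟩⟩

theorem exists_psi : ∃ ψ : SU5 →* Spin10, ∀ A : SU5, IsLift (ψ A) (A : Matrix _ _ ℂ) 1 :=
  exists_liftHom (Matrix.specialUnitaryGroup (Fin 2 ⊕ Fin 3) ℂ).subtype 1 (fun A => A.2.1)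
    (fun A => by simpa using SU.det_eq A)

/-- Two lifts differ by a sign at `B`, and the sign disappears at `B ^ 2`; every element of SU(5)
has this form as 5 is odd. -/
theorem IsSpinLift.unique {ψ₁ ψ₂ : SU5 →* Spin10} (h₁ : IsSpinLift ψ₁) (h₂ : IsSpinLift ψ₂) :
    ψ₁ = ψ₂ := by
  ext A : 1
  obtain ⟨B, rfl⟩ := exists_sq_eq_of_odd (n := Fin 2 ⊕ Fin 3) (by decide) A
  apply Subtype.ext
  rw [map_pow, map_pow, pow_two, pow_two, Submonoid.coe_mul, Submonoid.coe_mul]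
  rcases (h₁ B).eq_or_eq_neg (h₂ B) with h | h
  · rw [h]
  · rw [h, neg_mul_neg]

theorem IsSpinLift.injective {ψ : SU5 →* Spin10} (h : IsSpinLift ψ) : Function.Injective ψ := by
  intro A B hAB
  have hB := h B
  rw [← hAB] at hB
  exact Subtype.ext ((h A).matrix_eq hB)

theorem exists_phi_eq_of_blocks {A : SU5} {P : Matrix (Fin 2) (Fin 2) ℂ}
    {R : Matrix (Fin 3) (Fin 3) ℂ} (hA : (A : Matrix _ _ ℂ) = Matrix.fromBlocks P 0 0 R) :
    ∃ s, phi s = A := by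
  have hu := SU.isUnitary A
  have hd := SU.det_eq A
  rw [hA, Matrix.fromBlocks_conjTranspose, Matrix.fromBlocks_multiply, ← Matrix.fromBlocks_one,
    Matrix.fromBlocks_inj] at hu
  obtain ⟨hP, -, -, hR⟩ := hu
  simp only [Matrix.conjTranspose_zero, Matrix.mul_zero, add_zero,
    zero_add] at hP hR
  rw [hA, Matrix.det_fromBlocks_zero₂₁] at hd
  -- With `α ^ 6 = det P`, both `α⁻³ P` and `α² R` have determinant 1, the latter because `det P *
  -- det R = 1`.
  obtain ⟨a, ha⟩ := IsAlgClosed.exists_pow_nat_eq P.det (n := 6) (by norm_num)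
  have hPd : ‖P.det‖ = 1 := by
    have h := congrArg Matrix.det hP
    rw [Matrix.det_mul, Matrix.det_conjTranspose, Matrix.det_one, Complex.star_def,
      Complex.mul_conj, Complex.normSq_eq_norm_sq] at h
    have h' : ‖P.det‖ ^ 2 = 1 := by exact_mod_cast h
    exact (pow_eq_one_iff_of_nonneg (norm_nonneg _) two_ne_zero).1 h'
  have ha1 : ‖a‖ = 1 := by
    rw [← ha, norm_pow] at hPd
    exact (pow_eq_one_iff_of_nonneg (norm_nonneg _) (by norm_num)).1 hPd
  let α : Circle := ⟨a, by simpa [Submonoid.unitSphere] using ha1⟩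
  have hα : (α : ℂ) = a := rfl
  have ha0 : a ≠ 0 := α.coe_ne_zero
  have hmem : ∀ {n : Type} [Fintype n] [DecidableEq n] (z : Circle) (M : Matrix n n ℂ),
      M * Mᴴ = 1 → (z : ℂ) ^ Fintype.card n * M.det = 1 →
      (z : ℂ) • M ∈ Matrix.specialUnitaryGroup n ℂ := by
    intro n _ _ z M h1 h2
    rw [Matrix.mem_specialUnitaryGroup_iff, Matrix.mem_unitaryGroup_iff]
    refine ⟨?_, by rw [Matrix.det_smul, h2]⟩
    rw [Matrix.star_eq_conjTranspose, Matrix.conjTranspose_smul,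
      Matrix.smul_mul, Matrix.mul_smul, smul_smul, circle_mul_star, one_smul, h1]
  have hg := hmem (α ^ (-3 : ℤ)) P hP (by
    rw [← ha, Circle.coe_zpow, hα, Fintype.card_fin, zpow_neg]
    field_simp)
  have hh := hmem (α ^ 2) R hR (by
    rw [← ha] at hd
    rw [Circle.coe_pow, hα, Fintype.card_fin, ← pow_mul, hd])
  refine ⟨(α, ⟨_, hg⟩, ⟨_, hh⟩), Subtype.ext ?_⟩
  rw [hA, phi_coe]
  change Matrix.fromBlocks (((α ^ 3 : Circle) : ℂ) • ((α ^ (-3 : ℤ) : Circle) : ℂ) • P) 0 0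
    (((α ^ (-2 : ℤ) : Circle) : ℂ) • ((α ^ 2 : Circle) : ℂ) • R) = _
  rw [smul_smul, smul_smul, ← Circle.coe_mul, ← Circle.coe_mul]
  congr 1
  · simp
  · simp

theorem ker_phi_le_Z6 : phi.ker ≤ Z6 := by
  intro s hs
  have h0 := s.1.coe_ne_zero
  have h := congrArg Subtype.val (MonoidHom.mem_ker.1 hs)
  rw [phi_coe, Submonoid.coe_one, ← Matrix.fromBlocks_one, Matrix.fromBlocks_inj] at h
  obtain ⟨h1, -, -, h2⟩ := h
  refine ⟨?_, ?_, ?_⟩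
  -- `α ^ 6` is the determinant of the first block, which is the identity.
  · apply Circle.ext
    rw [Circle.coe_pow, ← det_weakRep, h1, Matrix.det_one, Circle.coe_one]
  · rw [← h1]
    change _ = _ • ((s.1 ^ 3 : Circle) : ℂ) • (s.2.1 : Matrix (Fin 2) (Fin 2) ℂ)
    rw [smul_smul, Circle.coe_pow, ← zpow_natCast, ← zpow_add₀ h0]
    simp
  · rw [← h2]
    change _ = _ • ((s.1 ^ (-2 : ℤ) : Circle) : ℂ) • (s.2.2 : Matrix (Fin 3) (Fin 3) ℂ)
    rw [smul_smul, Circle.coe_zpow, ← zpow_natCast, ← zpow_add₀ h0]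
    simp

theorem phiBar_injective : Function.Injective phiBar := by
  rw [injective_iff_map_eq_one]
  intro q hq
  induction q using QuotientGroup.induction_on with
  | H a => exact (QuotientGroup.eq_one_iff a).2 (ker_phi_le_Z6 hq)

/-- A commutative square of groups with injective vertical and bottom maps is a pullback if every
compatible pair comes from the top left corner. -/
theorem isPullback_of_injective {A B C D : Type} [Group A] [Group B] [Group C] [Group D]
    {f : A →* B} {g : A →* C} {h : B →* D} {k : C →* D} (hf : Function.Injective f)
    (hk : Function.Injective k) (comm : ∀ a, h (f a) = k (g a))
    (lift : ∀ b c, h b = k c → ∃ a, f a = b) :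
    CategoryTheory.IsPullback (GrpCat.ofHom f) (GrpCat.ofHom g) (GrpCat.ofHom h)
      (GrpCat.ofHom k) := by
  refine CategoryTheory.IsPullback.of_map (CategoryTheory.forget GrpCat) ?_ ?_
  · ext a
    exact comm a
  · rw [CategoryTheory.Limits.Types.isPullback_iff]
    refine ⟨?_, ?_, ?_⟩
    · ext a
      exact comm a
    · rintro a b ⟨hab, -⟩
      exact hf hab
    · intro b c hbc
      obtain ⟨a, ha⟩ := lift b c hbc
      -- Only the first coordinate has to be matched; injectivity of `k` gives the second.
      refine ⟨a, ha, hk ?_⟩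
      change k (g a) = k c
      rw [← comm, ha]
      exact hbc

end

end GUT

/-! ### The commutative square and its pullback property. -/

theorem theorem9 :
    ∃ (ψ : GUT.SU5 →* GUT.Spin10) (θ : GUT.GSM →* GUT.Spin4 × GUT.Spin6)
      (θBar : GUT.GSM ⧸ GUT.Z6 →* (GUT.Spin4 × GUT.Spin6) ⧸ GUT.Z2),
      (GUT.IsSpinLift ψ ∧ ∀ ψ₁, GUT.IsSpinLift ψ₁ → ψ₁ = ψ) ∧
      (GUT.IsTheta θ ∧ ∀ θ₁, GUT.IsTheta θ₁ → θ₁ = θ) ∧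
      (∀ s : GUT.GSM, θBar (QuotientGroup.mk s) = QuotientGroup.mk (θ s)) ∧
      Function.Injective GUT.phiBar ∧
      Function.Injective θBar ∧
      Function.Injective ψ ∧
      Function.Injective GUT.etaBar ∧
      (ψ.comp GUT.phiBar).range = ψ.range ⊓ GUT.etaBar.range ∧
      CategoryTheory.IsPullback (GrpCat.ofHom GUT.phiBar) (GrpCat.ofHom θBar)
        (GrpCat.ofHom ψ) (GrpCat.ofHom GUT.etaBar) := by
  obtain ⟨ψ, hψ⟩ := GUT.exists_psi
  obtain ⟨θ, hθ⟩ := GUT.exists_theta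
  have hlift : GUT.IsSpinLift ψ := fun A => (hψ A).covers
  have hθ' : GUT.IsTheta θ := fun s => GUT.alphaRel_of_isLift (hθ s).1 (hθ s).2
  have hcomm : ∀ s, ψ (GUT.phi s) = GUT.eta (θ s) := by
    intro s
    refine (hψ (GUT.phi s)).unique one_ne_zero ?_
    have h := GUT.isLift_eta (hθ s).1 (hθ s).2
    have hc : GUT.hyperchar (-3) s * GUT.hyperchar 3 s = 1 := by
      change ((s.1 ^ (-3 : ℤ) : Circle) : ℂ) * ((s.1 ^ (3 : ℤ) : Circle) : ℂ) = 1
      rw [← Circle.coe_mul, ← zpow_add]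
      simp
    rw [hc] at h
    exact h
  have hZ : GUT.Z6 ≤ ((QuotientGroup.mk' GUT.Z2).comp θ).ker := by
    intro s hs
    rw [MonoidHom.mem_ker, MonoidHom.comp_apply, QuotientGroup.mk'_apply,
      QuotientGroup.eq_one_iff]
    -- φ kills `Z6`, so by commutativity θ sends it into the kernel of η.
    refine GUT.ker_eta_le_Z2 ?_
    rw [MonoidHom.mem_ker, ← hcomm, GUT.Z6_le_ker_phi hs, map_one]
  let θBar := QuotientGroup.lift GUT.Z6 ((QuotientGroup.mk' GUT.Z2).comp θ) hZ
  have hsq : ∀ q, ψ (GUT.phiBar q) = GUT.etaBar (θBar q) := by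
    intro q
    induction q using QuotientGroup.induction_on with
    | H s => exact hcomm s
  have hlift' : ∀ A q, ψ A = GUT.etaBar q → ∃ s, GUT.phiBar s = A := by
    intro A q hA
    induction q using QuotientGroup.induction_on with
    | H xy =>
      have hcov := hlift A
      rw [hA] at hcov
      obtain ⟨P, R, hPR⟩ := GUT.exists_fromBlocks_of_covers_eta (x := xy.1) (y := xy.2) hcov
      obtain ⟨s, hs⟩ := GUT.exists_phi_eq_of_blocks hPR
      exact ⟨QuotientGroup.mk s, hs⟩
  refine ⟨ψ, θ, θBar, ⟨hlift, fun ψ₁ h => h.unique hlift⟩,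
    ⟨hθ', fun θ₁ h => MonoidHom.ext fun s => (h s).unique (hθ' s)⟩, fun s => rfl,
    GUT.phiBar_injective, ?_, hlift.injective, GUT.etaBar_injective, ?_,
    GUT.isPullback_of_injective GUT.phiBar_injective GUT.etaBar_injective hsq hlift'⟩
  · intro a b hab
    -- Injectivity of the induced θ is inherited from the composite of ψ with the induced φ, which
    -- factors through it.
    refine GUT.phiBar_injective (hlift.injective ?_)
    rw [hsq, hsq, hab]
  · ext z
    constructor
    · rintro ⟨q, rfl⟩
      exact ⟨⟨_, rfl⟩, ⟨θBar q, (hsq q).symm⟩⟩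
    · rintro ⟨⟨A, rfl⟩, ⟨q, hq⟩⟩
      obtain ⟨s, rfl⟩ := hlift' A q hq.symm
      exact ⟨s, rfl⟩
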